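/- Theorem 5 (Sliding-Window Robust MOSS). Consider a bandit problem with $K\ge 1$ arms and horizon $T$. An environment assigns to each slot $t\in\{1,\dots,T\}$ and each arm $k\in\{1,\dots,K\}$ a probability distribution on $\mathbb{R}$; the rewards $X_t^k$ with these distributions are independent, with means $\mu_t^k=\mathbb{E}[X_t^k]$, and are heavy-tailed in the sense that $\mathbb{E}[(X_t^k)^2]\le 1$ for all $t,k$. For $V_T>0$ let $\mathcal{E}(V_T,T,K)$ be the set of such environments with $$\sum_{t=1}^{T-1}\max_{k}\bigl|\mu_{t+1}^k-\mu_t^k\bigr|\le V_T .$$ A policy chooses the arm $\varphi_t$ from the past observations $(\varphi_s,X_s^{\varphi_s})_{s<t}$, and its regret is $R_T=\sum_{t=1}^T\max_k\mu_t^k-\mathbb{E}\bigl[\sum_{t=1}^T X_t^{\varphi_t}\bigr]$. Let $a>1$, $\zeta>0$, $\ln_+(x)=\max(\ln x,1)$, $\psi(x)=(1+1/x)\ln(1+x)-1$, $h(m)=a^{\lfloor\log_a m\rfloor+1}$, and for a window length $\tau$ and $m\ge 1$ let $$B_m=\sqrt{\frac{h(m)}{\ln_+\!\bigl(\tau/(K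 h(m))\bigr)}},\qquad c_m=\sqrt{\frac{\ln_+\!\bigl(\tau/(K m)\bigr)}{m}},\qquad \operatorname{sat}(x,B)=\operatorname{sign}(x)\min\{|x|,B\}.$$ Sliding-Window Robust MOSS (SW-RMOSS) selects each arm once during the first $K$ slots, in any order. At every slot $t>K$ it selects an arm $k$ that maximizes the index $$g_t^k=\frac{1}{n_k(t)}\sum_{s\in\mathcal{W}_t,\ \varphi_s=k}\operatorname{sat}\bigl(X_s^{\varphi_s},B_{n_k(t)}\bigr)+(1+\zeta)\,c_{n_k(t)},$$ with ties broken by any (measurable) rule, where $\mathcal{W}_t=\{\max(1,t-\tau),\dots,t-1\}$ and $n_k(t)=\#\{s\in\mathcal{W}_t:\varphi_s=k\}$; the index is $+\infty$ if $n_k(t)=0$. If $\psi(2\zeta/a)\ge 2a/\zeta$, then there is a constant $C>0$, depending only on $a$ and $\zeta$, such that for all $K\ge 1$, $T$ and $V_T>0$ for which the window length $\tau=\bigl\lceil K^{1/3}(T/V_T)^{2/3}\bigr\rceil$ satisfies $\tau\le T$, the worst-case regret of SW-RMOSS with this window length satisfies $$\sup_{\mathcal{E}(V_T,T,K)}R_T^{\text{SW-RMOSS}}\le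 C\,(K V_T)^{1/3}\,T^{2/3}.$$ -/

import Mathlib

open MeasureTheory

noncomputable section

namespace SWRMOSS

/-! ### Environments

Time slots are indexed by `Fin T` and arms by `Fin K`; slot `t` of the usual numbering
`1, …, T` is the element `t - 1` of `Fin T`. -/

/-- A (nonstationary) environment: a reward distribution for every slot and every arm. -/
abbrev Environment (K T : ℕ) : Type := Fin T → Fin K → ProbabilityMeasure ℝ

namespace Environment

variable {K T : ℕ}

/-- Mean reward of arm `k` at slot `t`. -/
def mean (ν : Environment K T) (t : Fin T) (k : Fin K) : ℝ :=
  ∫ x, x ∂(ν t k : Measure ℝ)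

/-- Largest mean reward at slot `t`. -/
def bestMean (ν : Environment K T) (t : Fin T) : ℝ :=
  ⨆ k : Fin K, ν.mean t k

/-- Total variation: the sum over consecutive slots of the largest change of a mean reward. -/
def variation (ν : Environment K T) : ℝ :=
  ∑ t : Fin T, if h : (t : ℕ) + 1 < T then
    ⨆ k : Fin K, |ν.mean ⟨(t : ℕ) + 1, h⟩ k - ν.mean t k| else 0

/-- Heavy-tailed rewards: every reward has second moment at most `1`. The second moment is
taken in `[0, ∞]`, so that its finiteness is part of the condition. -/
def HeavyTailed (ν : Environment K T) : Prop :=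
  ∀ t k, ∫⁻ x, ENNReal.ofReal (x ^ 2) ∂(ν t k : Measure ℝ) ≤ 1

/-- Joint law of the table of rewards `(X_t^k)`: all entries are independent, and the entry
`(t, k)` has law `ν t k`. -/
def rewardLaw (ν : Environment K T) : Measure (Fin T → Fin K → ℝ) :=
  Measure.pi fun t => Measure.pi fun k => (ν t k : Measure ℝ)

/-- The heavy-tailed environments whose total variation is within the budget `V`. -/
def withinBudget (K T : ℕ) (V : ℝ) : Set (Environment K T) :=
  {ν | ν.HeavyTailed ∧ ν.variation ≤ V}

end Environment

/-! ### Policies and regret -/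

/-- A (deterministic) policy chooses the arm of slot `t` from the arms selected and the rewards
observed in the `t` earlier slots. -/
abbrev Policy (K : ℕ) : Type := (t : ℕ) → (Fin t → Fin K × ℝ) → Fin K

namespace Policy

variable {K T : ℕ}

/-- The pairs (arm selected, reward received) of the first `t` slots, when `π` is played against
the table of rewards `x`. -/
def history (π : Policy K) (x : Fin T → Fin K → ℝ) :
    (t : ℕ) → t ≤ T → (Fin t → Fin K × ℝ)
  | 0, _ => Fin.elim0
  | t + 1, h =>
    let H := history π x t (Nat.le_of_succ_le h)
    Fin.snoc (α := fun _ => Fin K × ℝ) H (π t H, x ⟨t, h⟩ (π t H))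

/-- The arm selected by `π` at slot `t`, when played against the table of rewards `x`. -/
def arm (π : Policy K) (x : Fin T → Fin K → ℝ) (t : Fin T) : Fin K :=
  π t (π.history x t t.isLt.le)

/-- Regret of `π`: the sum of the largest mean rewards minus the expected cumulative reward. -/
def regret (π : Policy K) (ν : Environment K T) : ℝ :=
  (∑ t : Fin T, ν.bestMean t) - ∫ x, ∑ t : Fin T, x t (π.arm x t) ∂ν.rewardLaw

/-- Worst-case regret of `π` over the heavy-tailed environments with variation budget `V`. -/
def worstCaseRegret (π : Policy K) (T : ℕ) (V : ℝ) : EReal :=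
  ⨆ ν ∈ Environment.withinBudget K T V, (π.regret ν : EReal)

end Policy

/-! ### Sliding-Window Robust MOSS -/

/-- `ln₊ x = max (ln x) 1`. -/
def lnPlus (x : ℝ) : ℝ := max (Real.log x) 1

/-- `ψ x = (1 + 1 / x) ln (1 + x) - 1`. -/
def psi (x : ℝ) : ℝ := (1 + 1 / x) * Real.log (1 + x) - 1

/-- `h m = a ^ (⌊log_a m⌋ + 1)`, for `m ≥ 1`. -/
def gridUp (a : ℝ) (m : ℕ) : ℝ := a ^ (⌊Real.logb a m⌋₊ + 1)

/-- Saturation limit for `m` samples, window length `τ` and `K` arms. -/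
def satLimit (a : ℝ) (K τ m : ℕ) : ℝ :=
  Real.sqrt (gridUp a m / lnPlus ((τ : ℝ) / (K * gridUp a m)))

/-- The value `x` saturated at level `B`. -/
def sat (x B : ℝ) : ℝ := Real.sign x * min |x| B

/-- Confidence radius for `m` samples, window length `τ` and `K` arms. -/
def radius (K τ m : ℕ) : ℝ :=
  Real.sqrt (lnPlus ((τ : ℝ) / (K * m)) / m)

section Index

variable {K t : ℕ}

/-- The slots among the last `τ` ones before slot `t` in which arm `k` was selected. -/
def windowSlots (τ : ℕ) (H : Fin t → Fin K × ℝ) (k : Fin K) : Finset (Fin t) :=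
  {s | t ≤ (s : ℕ) + τ ∧ (H s).1 = k}

/-- Saturated mean of the rewards of arm `k` within the window. -/
def satMean (a : ℝ) (τ : ℕ) (H : Fin t → Fin K × ℝ) (k : Fin K) : ℝ :=
  1 / ((windowSlots τ H k).card : ℝ) *
    ∑ s ∈ windowSlots τ H k, sat (H s).2 (satLimit a K τ (windowSlots τ H k).card)

/-- Upper confidence index of arm `k`; it is `+∞` if the arm has no sample in the window. -/
def ucbIndex (a ζ : ℝ) (τ : ℕ) (H : Fin t → Fin K × ℝ) (k : Fin K) : EReal :=
  if (windowSlots τ H k).card = 0 then ⊤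
  else ((satMean a τ H k + (1 + ζ) * radius K τ (windowSlots τ H k).card : ℝ) : EReal)

end Index

/-- `π` is Sliding-Window Robust MOSS with parameters `a`, `ζ` and window length `τ`: in the
first `K` slots it selects each arm once, and afterwards it selects an arm of maximal index.
The order of the first `K` selections and the way ties are broken are arbitrary. -/
structure IsSWRMOSS {K : ℕ} (a ζ : ℝ) (τ : ℕ) (π : Policy K) : Prop where
  measurable : ∀ t, Measurable (π t)
  initial : ∀ t < K, ∀ (H : Fin t → Fin K × ℝ) (s : Fin t), (H s).1 ≠ π t H
  maximal : ∀ t, K ≤ t → ∀ (H : Fin t → Fin K × ℝ) (k : Fin K),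
    ucbIndex a ζ τ H k ≤ ucbIndex a ζ τ H (π t H)

/-- The window length `⌈K ^ (1/3) * (T / V) ^ (2/3)⌉`. -/
def windowLength (K T : ℕ) (V : ℝ) : ℕ :=
  ⌈(K : ℝ) ^ (1 / 3 : ℝ) * ((T : ℝ) / V) ^ (2 / 3 : ℝ)⌉₊

end SWRMOSS

end

/-! Write `ρ ^ 4 = τ / K`. The regret is the expected sum of mean gaps (`regret_eq`). By maximality
of the index, a gap is at most the shortfall of the best arm's index below its mean plus the excess
of the selected arm's index above its mean (`loss_le`). Each of the two errors is made of the change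
of the means inside the window, the saturation bias `1 / B`, the confidence radius and the noise of
the saturated rewards. The drift costs `2 τ V` in total and the rest costs `O(T / ρ ^ 2) = O(T √(K /
τ))`; the prescribed window length balances the two.

Shortfall: the best arm of a slot is not random, so a Bennett-type supermartingale bounds the
exponential moment of its window noise (`lintegral_exp_noiseSum_le`). The random sample size is
handled by a sum over the levels `a ^ l`, since the saturation limit is constant on each level. The
condition on `psi` makes the weight of level `l` at most a multiple of `exp (-ln₊ (τ / (K a ^ l))) /
√(a ^ l)`, and these weights sum to `O(1 / ρ ^ 2)` (`sum_expCoeff_le`).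

Excess: the selected arm is random and correlated with its own noise, and a sum over all arms would
lose a factor `K`. Deviations up to `slack` are tolerated and summed by counting selections
(`sum_slack_le`). Larger ones are charged to fourth powers of window sums at the selected arm. The
selections of each arm are cut into blocks of `H`; a window with at most `H` samples meets two
blocks, and a maximal inequality bounds the fourth moment of a block's largest partial sum by the
expected number of its selections (`lintegral_blockMax_pow_le`). These numbers add up to at most `T`
over all blocks and arms, so `K` does not enter (`lintegral_sum_noiseSum_pow_le`).

Independence is used only through resampling one row of the reward table, which replaces
conditioning on the past. -/

open MeasureTheory

noncomputable section

namespace SWRMOSS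

section

/-! ### Resampling one slot of the reward table -/

/-- Resampling one coordinate does not change a product of probability measures. -/
theorem map_update_pi {ι : Type*} [Fintype ι] [DecidableEq ι] {X : ι → Type*}
    [∀ i, MeasurableSpace (X i)] (μ : ∀ i, Measure (X i)) [∀ i, IsProbabilityMeasure (μ i)]
    (i : ι) :
    ((Measure.pi μ).prod (μ i)).map (fun p => Function.update p.1 i p.2) = Measure.pi μ := by
  have hm : Measurable (fun p : (∀ j, X j) × X i => Function.update p.1 i p.2) := by
    rw [measurable_pi_iff]
    intro j
    by_cases h : j = i
    · subst h
      simpa using measurable_snd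
    · simp only [Function.update_of_ne h]
      fun_prop
  symm
  apply Measure.pi_eq
  intro s hs
  rw [Measure.map_apply hm (MeasurableSet.univ_pi hs)]
  have : (fun p : (∀ j, X j) × X i => Function.update p.1 i p.2) ⁻¹' (Set.univ.pi s)
      = (Set.univ.pi (Function.update s i Set.univ)) ×ˢ (s i) := by
    ext p
    simp only [Set.mem_preimage, Set.mem_pi, Set.mem_univ, true_implies, Set.mem_prod]
    constructor
    · intro h
      refine ⟨fun j => ?_, by simpa using h i⟩
      by_cases hj : j = i
      · subst hj; simp
      · simpa [Function.update_of_ne hj] using h j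
    · rintro ⟨h1, h2⟩ j
      by_cases hj : j = i
      · subst hj; simpa using h2
      · simpa [Function.update_of_ne hj] using h1 j
  rw [this, Measure.prod_prod, Measure.pi_pi]
  rw [← Finset.mul_prod_erase Finset.univ (fun j => μ j (s j)) (Finset.mem_univ i),
    ← Finset.mul_prod_erase Finset.univ (fun j => μ j (Function.update s i Set.univ j))
      (Finset.mem_univ i)]
  simp only [Function.update_self, measure_univ, one_mul]
  rw [mul_comm]
  congr 1
  refine Finset.prod_congr rfl fun j hj => ?_
  rw [Function.update_of_ne (Finset.ne_of_mem_erase hj)]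

variable {K T : ℕ}

theorem measurable_updateTable (s : Fin T) :
    Measurable (fun p : (Fin T → Fin K → ℝ) × (Fin K → ℝ) => Function.update p.1 s p.2) := by
  rw [measurable_pi_iff]
  intro j
  by_cases h : j = s
  · subst h
    simpa using measurable_snd
  · simp only [Function.update_of_ne h]
    fun_prop

instance isProbabilityMeasure_rewardLaw (ν : Environment K T) : IsProbabilityMeasure ν.rewardLaw := by
  unfold Environment.rewardLaw; infer_instance

/-- Serves as conditional expectation: the inner integral averages over row `s` with all other rows
frozen. -/
theorem lintegral_rewardLaw_update (ν : Environment K T) (s : Fin T)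
    {F : (Fin T → Fin K → ℝ) → ENNReal} (hF : Measurable F) :
    ∫⁻ x, F x ∂ν.rewardLaw = ∫⁻ x, ∫⁻ y, F (Function.update x s y)
      ∂(Measure.pi fun k => (ν s k : Measure ℝ)) ∂ν.rewardLaw := by
  have h := map_update_pi (fun t => Measure.pi fun k => (ν t k : Measure ℝ)) s
  have hm := measurable_updateTable (K := K) s
  conv_lhs => rw [Environment.rewardLaw, ← h]
  rw [lintegral_map hF hm]
  exact lintegral_prod _ (hF.comp hm).aemeasurable

theorem integral_rewardLaw_update (ν : Environment K T) (s : Fin T)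
    {F : (Fin T → Fin K → ℝ) → ℝ} (hF : Measurable F) (hi : Integrable F ν.rewardLaw) :
    ∫ x, F x ∂ν.rewardLaw = ∫ x, ∫ y, F (Function.update x s y)
      ∂(Measure.pi fun k => (ν s k : Measure ℝ)) ∂ν.rewardLaw := by
  have h := map_update_pi (fun t => Measure.pi fun k => (ν t k : Measure ℝ)) s
  have hm := measurable_updateTable (K := K) s
  have hi' := hi
  rw [Environment.rewardLaw, ← h] at hi'
  rw [integrable_map_measure hF.aestronglyMeasurable hm.aemeasurable] at hi'
  conv_lhs => rw [Environment.rewardLaw, ← h]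
  rw [integral_map hm.aemeasurable hF.aestronglyMeasurable]
  exact integral_prod _ hi'

theorem lintegral_pi_eval (ν : Environment K T) (s : Fin T) (k : Fin K) {f : ℝ → ENNReal}
    (hf : Measurable f) :
    ∫⁻ y, f (y k) ∂(Measure.pi fun k => (ν s k : Measure ℝ)) = ∫⁻ z, f z ∂(ν s k : Measure ℝ) :=
  (measurePreserving_eval (fun k => (ν s k : Measure ℝ)) k).lintegral_comp hf

/-! ### Histories -/

namespace Policy

variable (π : Policy K)

theorem history_apply (x : Fin T → Fin K → ℝ) (t : ℕ) (h : t ≤ T) (s : Fin t) :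
    π.history x t h s = (π.arm x ⟨s, s.isLt.trans_le h⟩,
      x ⟨s, s.isLt.trans_le h⟩ (π.arm x ⟨s, s.isLt.trans_le h⟩)) := by
  induction t with
  | zero => exact s.elim0
  | succ t ih =>
    refine Fin.lastCases ?_ (fun i => ?_) s
    · simp [history, arm]
    · simp only [history, Fin.snoc_castSucc]
      exact ih _ i

theorem history_update (x : Fin T → Fin K → ℝ) (s : Fin T) (y : Fin K → ℝ) (t : ℕ) (h : t ≤ T)
    (hts : t ≤ s) : π.history (Function.update x s y) t h = π.history x t h := by
  induction t with
  | zero => rfl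
  | succ t ih =>
    have hne : (⟨t, h⟩ : Fin T) ≠ s := by
      intro he
      rw [← he] at hts
      simp at hts
    simp only [history, ih (Nat.le_of_succ_le h) (by omega), Function.update_of_ne hne]

/-- The case `r = s` is included: the choice at a slot uses strictly earlier rewards only. -/
theorem arm_update (x : Fin T → Fin K → ℝ) (s : Fin T) (y : Fin K → ℝ) (r : Fin T) (hrs : r ≤ s) :
    π.arm (Function.update x s y) r = π.arm x r := by
  simp only [arm, π.history_update x s y r r.isLt.le hrs]

variable {π}

theorem measurable_history (hπ : ∀ t, Measurable (π t)) (t : ℕ) (h : t ≤ T) :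
    Measurable (fun x : Fin T → Fin K → ℝ => π.history x t h) := by
  induction t with
  | zero =>
    rw [measurable_pi_iff]
    exact fun i => i.elim0
  | succ t ih =>
    have h0 := ih (Nat.le_of_succ_le h)
    have h1 : Measurable fun x : Fin T → Fin K → ℝ => π t (π.history x t (Nat.le_of_succ_le h)) :=
      (hπ t).comp h0
    rw [measurable_pi_iff]
    intro i
    refine Fin.lastCases ?_ (fun i => ?_) i
    · simp only [history, Fin.snoc_last]
      refine h1.prodMk ?_
      have : Measurable (fun p : (Fin K → ℝ) × Fin K => p.1 p.2) :=
        measurable_from_prod_countable_left fun k => measurable_pi_apply k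
      exact this.comp ((measurable_pi_apply _).prodMk h1)
    · simp only [history, Fin.snoc_castSucc]
      exact (measurable_pi_apply i).comp h0

theorem measurable_arm (hπ : ∀ t, Measurable (π t)) (t : Fin T) :
    Measurable (fun x : Fin T → Fin K → ℝ => π.arm x t) :=
  (hπ t).comp (measurable_history hπ t t.isLt.le)

end Policy

end

section

/-! ### Saturated rewards -/

theorem sat_eq_max_min (x : ℝ) {B : ℝ} (hB : 0 ≤ B) : sat x B = max (-B) (min x B) := by
  unfold sat
  rcases lt_trichotomy x 0 with h | h | h
  · rw [Real.sign_of_neg h, abs_of_neg h, min_eq_left (by linarith : x ≤ B)]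
    rcases le_total (-x) B with h1 | h1
    · rw [min_eq_left h1, max_eq_right (by linarith)]; ring
    · rw [min_eq_right h1, max_eq_left (by linarith)]; ring
  · subst h
    simp [hB]
  · rw [Real.sign_of_pos h, abs_of_pos h, max_eq_right]
    · ring
    · exact (neg_nonpos.2 hB).trans (le_min h.le hB)

theorem measurable_sat {B : ℝ} (hB : 0 ≤ B) : Measurable fun x => sat x B := by
  simp only [sat_eq_max_min _ hB]
  fun_prop

theorem abs_sat_le (x : ℝ) {B : ℝ} (hB : 0 ≤ B) : |sat x B| ≤ B := by
  rw [sat_eq_max_min _ hB, abs_le]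
  exact ⟨le_max_left _ _, max_le (by linarith) (min_le_right _ _)⟩

theorem abs_sat_le_abs (x : ℝ) {B : ℝ} (hB : 0 ≤ B) : |sat x B| ≤ |x| := by
  rw [sat_eq_max_min _ hB, abs_le]
  constructor
  · refine le_max_of_le_right (le_min (neg_abs_le x) ?_)
    linarith [abs_nonneg x]
  · exact max_le (by linarith [abs_nonneg x]) ((min_le_left _ _).trans (le_abs_self x))

/-- The error vanishes for `|x| ≤ B` and is `|x| - B` otherwise. Integrated against a second moment
of at most `1`, it gives the bias `1 / B`. -/
theorem abs_sat_sub_le (x : ℝ) {B : ℝ} (hB : 0 < B) : |sat x B - x| ≤ x ^ 2 / B := by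
  rw [sat_eq_max_min _ hB.le, le_div_iff₀ hB]
  rcases le_total x B with h | h
  · rw [min_eq_left h]
    rcases le_total (-B) x with h' | h'
    · rw [max_eq_right h']; simp; positivity
    · rw [max_eq_left h', abs_of_nonneg (by linarith)]; nlinarith
  · rw [min_eq_right h, max_eq_right (by linarith), abs_of_nonpos (by linarith)]; nlinarith

section SecondMoment

variable {μ : Measure ℝ}

theorem integrable_sq_of_lintegral_le (hμ : ∫⁻ x, ENNReal.ofReal (x ^ 2) ∂μ ≤ 1) :
    Integrable (fun x : ℝ => x ^ 2) μ := by
  refine ⟨by fun_prop, ?_⟩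
  rw [hasFiniteIntegral_iff_ofReal (by filter_upwards with x using sq_nonneg x)]
  exact hμ.trans_lt (by simp)

theorem integral_sq_le_one (hμ : ∫⁻ x, ENNReal.ofReal (x ^ 2) ∂μ ≤ 1) : ∫ x, x ^ 2 ∂μ ≤ 1 := by
  rw [integral_eq_lintegral_of_nonneg_ae (by filter_upwards with x using sq_nonneg x)
    (by fun_prop)]
  exact ENNReal.toReal_mono (by simp) hμ

variable [IsProbabilityMeasure μ]

theorem integrable_id_of_lintegral_le (hμ : ∫⁻ x, ENNReal.ofReal (x ^ 2) ∂μ ≤ 1) :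
    Integrable (fun x : ℝ => x) μ := by
  refine ((integrable_const (1 : ℝ)).add (integrable_sq_of_lintegral_le hμ)).mono' (by fun_prop) ?_
  filter_upwards with x
  simp only [Real.norm_eq_abs, Pi.add_apply]
  nlinarith [sq_nonneg (|x| - 1), sq_abs x, abs_nonneg x]

theorem abs_integral_id_le_one (hμ : ∫⁻ x, ENNReal.ofReal (x ^ 2) ∂μ ≤ 1) :
    |∫ x, x ∂μ| ≤ 1 := by
  have hq := integrable_sq_of_lintegral_le hμ
  calc |∫ x, x ∂μ| ≤ ∫ x, |x| ∂μ := abs_integral_le_integral_abs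
    _ ≤ ∫ x, (1 + x ^ 2) / 2 ∂μ := by
        refine integral_mono (integrable_id_of_lintegral_le hμ).abs
          (((integrable_const (1 : ℝ)).add hq).div_const 2) fun x => ?_
        show |x| ≤ (1 + x ^ 2) / 2
        nlinarith [sq_nonneg (|x| - 1), sq_abs x]
    _ = (1 + ∫ x, x ^ 2 ∂μ) / 2 := by
        rw [integral_div, integral_add (integrable_const _) hq]; simp
    _ ≤ 1 := by linarith [integral_sq_le_one hμ]

theorem integrable_sat {B : ℝ} (hB : 0 ≤ B) : Integrable (fun x => sat x B) μ := by
  refine Integrable.of_bound (measurable_sat hB).aestronglyMeasurable B ?_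
  filter_upwards with x using abs_sat_le x hB

theorem abs_integral_sat_sub_le {B : ℝ} (hB : 0 < B)
    (hμ : ∫⁻ x, ENNReal.ofReal (x ^ 2) ∂μ ≤ 1) :
    |∫ x, sat x B ∂μ - ∫ x, x ∂μ| ≤ 1 / B := by
  have hs := integrable_sat (μ := μ) hB.le
  have hx := integrable_id_of_lintegral_le hμ
  rw [← integral_sub hs hx]
  calc |∫ x, (sat x B - x) ∂μ| ≤ ∫ x, |sat x B - x| ∂μ := abs_integral_le_integral_abs
    _ ≤ ∫ x, x ^ 2 / B ∂μ := integral_mono (hs.sub hx).abs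
          ((integrable_sq_of_lintegral_le hμ).div_const B) fun x => abs_sat_sub_le x hB
    _ = (∫ x, x ^ 2 ∂μ) / B := integral_div _ _
    _ ≤ 1 / B := by gcongr; exact integral_sq_le_one hμ

theorem abs_integral_sat_le {B : ℝ} (hB : 0 ≤ B) : |∫ x, sat x B ∂μ| ≤ B := by
  have := norm_integral_le_of_norm_le_const (μ := μ) (f := fun x => sat x B) (C := B)
    (by filter_upwards with x using abs_sat_le x hB)
  simpa using this

/-- A nonnegative quadratic polynomial in a centered saturated reward, integrated. -/
theorem lintegral_quadratic_le {B : ℝ} (hB : 0 ≤ B)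
    (hμ : ∫⁻ x, ENNReal.ofReal (x ^ 2) ∂μ ≤ 1) {p q r : ℝ} (hr : 0 ≤ r)
    (hnn : ∀ z, 0 ≤ p + q * (sat z B - ∫ x, sat x B ∂μ) + r * (sat z B - ∫ x, sat x B ∂μ) ^ 2) :
    ∫⁻ z, ENNReal.ofReal (p + q * (sat z B - ∫ x, sat x B ∂μ)
      + r * (sat z B - ∫ x, sat x B ∂μ) ^ 2) ∂μ ≤ ENNReal.ofReal (p + r) := by
  set m := ∫ x, sat x B ∂μ with hm
  have hs := integrable_sat (μ := μ) hB
  have hs2 : Integrable (fun x => sat x B ^ 2) μ := by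
    refine Integrable.of_bound ((measurable_sat hB).pow_const 2).aestronglyMeasurable (B ^ 2) ?_
    filter_upwards with x
    rw [Real.norm_eq_abs, abs_pow]
    exact pow_le_pow_left₀ (abs_nonneg _) (abs_sat_le x hB) 2
  have hsq : ∫ x, sat x B ^ 2 ∂μ ≤ 1 := by
    refine le_trans (integral_mono hs2 (integrable_sq_of_lintegral_le hμ) fun x => ?_)
      (integral_sq_le_one hμ)
    exact sq_le_sq.2 (abs_sat_le_abs x hB)
  have hexp : ∀ z, p + q * (sat z B - m) + r * (sat z B - m) ^ 2
      = (p - q * m + r * m ^ 2) + ((q - 2 * r * m) * sat z B + r * sat z B ^ 2) := fun z => by ring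
  have hint : Integrable (fun z => p + q * (sat z B - m) + r * (sat z B - m) ^ 2) μ := by
    simp only [hexp]
    exact (integrable_const _).add ((hs.const_mul _).add (hs2.const_mul _))
  rw [← ofReal_integral_eq_lintegral_ofReal hint (by filter_upwards with z using hnn z)]
  apply ENNReal.ofReal_le_ofReal
  simp only [hexp]
  have hs3 : Integrable (fun x => (q - 2 * r * m) * sat x B + r * sat x B ^ 2) μ :=
    (hs.const_mul _).add (hs2.const_mul _)
  rw [integral_add (integrable_const _) hs3,
    integral_add (hs.const_mul _) (hs2.const_mul _), integral_const_mul, integral_const_mul, ← hm]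
  simp only [integral_const, probReal_univ, smul_eq_mul, one_mul]
  -- The linear term integrates to zero; what remains is `r` times a variance, which is at most `1`.
  nlinarith [mul_le_mul_of_nonneg_left hsq hr, mul_nonneg hr (sq_nonneg m)]

end SecondMoment

/-! ### Selections and noise along a run of a policy -/

variable {K T : ℕ}

/-- `1` if `π` selects arm `k` at slot `s < T` against the table `x`, and `0` otherwise. -/
def pulled (π : Policy K) (k : Fin K) (s : ℕ) (x : Fin T → Fin K → ℝ) : ℕ :=
  if h : s < T then if π.arm x ⟨s, h⟩ = k then 1 else 0 else 0

/-- The number of selections of arm `k` in the slots `s, …, t - 1`. -/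
def pullCount (π : Policy K) (k : Fin K) (s t : ℕ) (x : Fin T → Fin K → ℝ) : ℕ :=
  ∑ r ∈ Finset.Ico s t, pulled π k r x

/-- The centered saturated reward of arm `k` at slot `s` if the arm is selected, and `0`
otherwise. -/
def noise (π : Policy K) (ν : Environment K T) (B : ℝ) (k : Fin K) (s : ℕ)
    (x : Fin T → Fin K → ℝ) : ℝ :=
  if h : s < T then
    if π.arm x ⟨s, h⟩ = k then sat (x ⟨s, h⟩ k) B - ∫ z, sat z B ∂(ν ⟨s, h⟩ k : Measure ℝ) else 0
  else 0

/-- `f` depends only on the rewards of the slots before `s`. -/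
def DependsOnPast {α : Type*} (s : ℕ) (f : (Fin T → Fin K → ℝ) → α) : Prop :=
  ∀ x (r : Fin T) y, s ≤ r → f (Function.update x r y) = f x

section Run

variable {π : Policy K} {ν : Environment K T} {B : ℝ} {k : Fin K}

theorem DependsOnPast.mono {α : Type*} {s t : ℕ} {f : (Fin T → Fin K → ℝ) → α}
    (hf : DependsOnPast s f) (hst : s ≤ t) : DependsOnPast t f :=
  fun x r y h => hf x r y (hst.trans h)

theorem dependsOnPast_pulled (s : ℕ) : DependsOnPast s (pulled (T := T) π k s) := by
  intro x r y h
  unfold pulled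
  by_cases hs : s < T
  · simp only [hs, dite_true, π.arm_update x r y ⟨s, hs⟩ h]
  · simp [hs]

theorem dependsOnPast_noise (s : ℕ) : DependsOnPast (s + 1) (noise π ν B k s) := by
  intro x r y h
  unfold noise
  by_cases hs : s < T
  · have hne : (⟨s, hs⟩ : Fin T) ≠ r := by
      intro he; rw [← he] at h; simp at h
    have hle : (⟨s, hs⟩ : Fin T) ≤ r := by
      rw [Fin.le_def]; simp; omega
    simp only [hs, dite_true, π.arm_update x r y _ hle, Function.update_of_ne hne]
  · simp [hs]

/-- `u + 1` is allowed because the selection at slot `u` is determined before the reward of slot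
`u`. -/
theorem dependsOnPast_pullCount (s t u : ℕ) (h : t ≤ u + 1) :
    DependsOnPast u (pullCount (T := T) π k s t) := by
  intro x r y hr
  refine Finset.sum_congr rfl fun i hi => ?_
  rw [Finset.mem_Ico] at hi
  exact (dependsOnPast_pulled i).mono (by omega) x r y hr

theorem pulled_le_one (s : ℕ) (x : Fin T → Fin K → ℝ) : pulled π k s x ≤ 1 := by
  unfold pulled; split_ifs <;> simp

theorem abs_noise_le (hB : 0 ≤ B) (s : ℕ) (x : Fin T → Fin K → ℝ) :
    |noise π ν B k s x| ≤ 2 * B := by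
  unfold noise
  split_ifs with h1 h2
  · refine (abs_sub _ _).trans ?_
    linarith [abs_sat_le (x ⟨s, h1⟩ k) hB, abs_integral_sat_le (μ := (ν ⟨s, h1⟩ k : Measure ℝ)) hB]
  · simpa using hB
  · simpa using hB

theorem measurable_pulled (hπ : ∀ t, Measurable (π t)) (s : ℕ) :
    Measurable (pulled (T := T) π k s) := by
  unfold pulled
  by_cases h : s < T
  · simp only [h, dite_true]
    exact Measurable.ite (Policy.measurable_arm hπ _ (measurableSet_singleton k))
      measurable_const measurable_const
  · simp only [h, dite_false]
    exact measurable_const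

theorem measurable_pullCount (hπ : ∀ t, Measurable (π t)) (s t : ℕ) :
    Measurable (pullCount (T := T) π k s t) :=
  Finset.measurable_fun_sum _ fun r _ => measurable_pulled hπ r

theorem measurable_noise (hπ : ∀ t, Measurable (π t)) (hB : 0 ≤ B) (s : ℕ) :
    Measurable (noise π ν B k s) := by
  unfold noise
  by_cases h : s < T
  · simp only [h, dite_true]
    refine Measurable.ite (Policy.measurable_arm hπ _ (measurableSet_singleton k)) ?_
      measurable_const
    exact ((measurable_sat hB).comp (by fun_prop)).sub_const _
  · simp only [h, dite_false]
    exact measurable_const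

/-- One step of a supermartingale argument: a nonnegative quadratic polynomial in the noise of
slot `s`, with coefficients that depend on the past. -/
theorem lintegral_noise_quadratic_le (hπ : ∀ t, Measurable (π t)) (hν : ν.HeavyTailed)
    (hB : 0 ≤ B) (s : ℕ) {p q r : (Fin T → Fin K → ℝ) → ℝ}
    (hpm : Measurable p) (hqm : Measurable q) (hrm : Measurable r)
    (hp : DependsOnPast s p) (hq : DependsOnPast s q) (hr : DependsOnPast s r)
    (hr0 : ∀ x, 0 ≤ r x)
    (hnn : ∀ x, 0 ≤ p x + q x * noise π ν B k s x + r x * noise π ν B k s x ^ 2) :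
    ∫⁻ x, ENNReal.ofReal (p x + q x * noise π ν B k s x + r x * noise π ν B k s x ^ 2)
        ∂ν.rewardLaw
      ≤ ∫⁻ x, ENNReal.ofReal (p x + r x * pulled π k s x) ∂ν.rewardLaw := by
  by_cases hs : s < T
  · have hYm := measurable_noise (ν := ν) (k := k) hπ hB s
    -- Row `s` is integrated first. The coefficients and the selection at `s` do not depend on it,
    -- so only the law of one reward matters.
    rw [lintegral_rewardLaw_update ν ⟨s, hs⟩ (by fun_prop)]
    refine lintegral_mono fun x => ?_
    have harm : ∀ y, π.arm (Function.update x ⟨s, hs⟩ y) ⟨s, hs⟩ = π.arm x ⟨s, hs⟩ :=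
      fun y => π.arm_update x _ y _ le_rfl
    have hnn' := fun y => hnn (Function.update x ⟨s, hs⟩ y)
    simp only [hp x ⟨s, hs⟩ _ le_rfl, hq x ⟨s, hs⟩ _ le_rfl, hr x ⟨s, hs⟩ _ le_rfl] at hnn' ⊢
    by_cases hk : π.arm x ⟨s, hs⟩ = k
    · simp only [noise, hs, dite_true, harm, hk, if_true, Function.update_self, pulled,
        Nat.cast_one, mul_one] at hnn' ⊢
      rw [lintegral_pi_eval ν ⟨s, hs⟩ k (f := fun z => ENNReal.ofReal (p x +
        q x * (sat z B - ∫ z, sat z B ∂(ν ⟨s, hs⟩ k : Measure ℝ)) +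
        r x * (sat z B - ∫ z, sat z B ∂(ν ⟨s, hs⟩ k : Measure ℝ)) ^ 2))]
      · exact lintegral_quadratic_le hB (hν _ _) (hr0 x) fun z => by
          simpa using hnn' (fun _ => z)
      · have := measurable_sat hB
        fun_prop
    · simp [noise, hs, harm, hk, pulled]
  · refine lintegral_mono fun x => ENNReal.ofReal_le_ofReal ?_
    simp [noise, hs, pulled]

end Run

end

section

/-! ### Exponential moments of the noise -/

/-- The quotient `(exp z - 1 - z) / z ^ 2` is increasing. For `z ≤ 0` both sides are compared
through its value `1 / 2` at `0`; for `z > 0` the power series are compared term by term. -/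
theorem exp_sub_one_sub_mul_sq_le {z c : ℝ} (hc : 0 < c) (hz : z ≤ c) :
    (Real.exp z - 1 - z) * c ^ 2 ≤ (Real.exp c - 1 - c) * z ^ 2 := by
  rcases le_or_gt z 0 with h | h
  · have h1 : Real.exp z ≤ 1 + z + z ^ 2 / 2 := by
      have h2 := Real.quadratic_le_exp_of_nonneg (x := -z) (by linarith)
      have h3 : Real.exp z * Real.exp (-z) = 1 := by rw [← Real.exp_add]; simp
      have h4 := Real.exp_pos z
      have h5 : 0 < 1 + -z + (-z) ^ 2 / 2 := by nlinarith
      by_contra hcon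
      push Not at hcon
      have h6 : 0 < 1 + z + z ^ 2 / 2 := by nlinarith [sq_nonneg (z + 1)]
      nlinarith [mul_lt_mul hcon h2 h5 h4.le, sq_nonneg (z ^ 2)]
    have h2 := Real.quadratic_le_exp_of_nonneg hc.le
    nlinarith [mul_le_mul_of_nonneg_right h1 (sq_nonneg c),
      mul_le_mul_of_nonneg_right h2 (sq_nonneg z)]
  · have hs : ∀ w : ℝ, HasSum (fun n : ℕ => w ^ (n + 2) / (n + 2).factorial)
        (Real.exp w - 1 - w) := by
      intro w
      have h0 : HasSum (fun n : ℕ => w ^ n / n.factorial) (Real.exp w) := by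
        rw [Real.exp_eq_exp_ℝ]
        exact NormedSpace.expSeries_div_hasSum_exp w
      have h1 := (hasSum_nat_add_iff' 2).2 h0
      simpa [Finset.sum_range_succ, sub_sub] using h1
    refine hasSum_le (fun n => ?_) ((hs z).mul_right (c ^ 2)) ((hs c).mul_right (z ^ 2))
    rw [div_mul_eq_mul_div, div_mul_eq_mul_div]
    gcongr ?_ / _
    calc z ^ (n + 2) * c ^ 2 = z ^ n * (z ^ 2 * c ^ 2) := by ring
      _ ≤ c ^ n * (z ^ 2 * c ^ 2) := by gcongr
      _ = c ^ (n + 2) * z ^ 2 := by ring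

variable {K T : ℕ} {π : Policy K} {ν : Environment K T} {B : ℝ} {k : Fin K}

/-- The sum of the noise of arm `k` over the slots `s, …, t - 1`. -/
def noiseSum (π : Policy K) (ν : Environment K T) (B : ℝ) (k : Fin K) (s t : ℕ)
    (x : Fin T → Fin K → ℝ) : ℝ :=
  ∑ r ∈ Finset.Ico s t, noise π ν B k r x

theorem measurable_noiseSum (hπ : ∀ t, Measurable (π t)) (hB : 0 ≤ B) (s t : ℕ) :
    Measurable (noiseSum π ν B k s t) :=
  Finset.measurable_fun_sum _ fun r _ => measurable_noise hπ hB r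

theorem dependsOnPast_noiseSum (s t : ℕ) : DependsOnPast t (noiseSum π ν B k s t) := by
  intro x r y hr
  refine Finset.sum_congr rfl fun i hi => ?_
  rw [Finset.mem_Ico] at hi
  exact (dependsOnPast_noise i).mono (by omega) x r y hr

theorem noiseSum_succ {s t : ℕ} (h : s ≤ t) (x : Fin T → Fin K → ℝ) :
    noiseSum π ν B k s (t + 1) x = noiseSum π ν B k s t x + noise π ν B k t x :=
  Finset.sum_Ico_succ_top h _

theorem pullCount_succ {s t : ℕ} (h : s ≤ t) (x : Fin T → Fin K → ℝ) :
    pullCount π k s (t + 1) x = pullCount π k s t x + pulled π k t x :=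
  Finset.sum_Ico_succ_top h _

/-- Compensator of the exponential moment, per selection. -/
def expRate (B l : ℝ) : ℝ := (Real.exp (2 * B * l) - 1 - 2 * B * l) / (2 * B) ^ 2

theorem expRate_nonneg (B l : ℝ) : 0 ≤ expRate B l :=
  div_nonneg (by linarith [Real.add_one_le_exp (2 * B * l)]) (sq_nonneg _)

theorem lintegral_exp_noiseSum_le (hπ : ∀ t, Measurable (π t)) (hν : ν.HeavyTailed)
    (hB : 0 < B) {l : ℝ} (hl : 0 < l) {s t : ℕ} (hst : s ≤ t) :
    ∫⁻ x, ENNReal.ofReal (Real.exp (-l * noiseSum π ν B k s t x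
      - expRate B l * pullCount π k s t x)) ∂ν.rewardLaw ≤ 1 := by
  induction t, hst using Nat.le_induction with
  | base => simp [noiseSum, pullCount]
  | succ t hst ih =>
    refine le_trans ?_ ih
    set g := expRate B l with hg
    have hg0 : 0 ≤ g := expRate_nonneg B l
    -- The count already includes slot `t`, which keeps `p` a function of the past; the step then
    -- gains `1 + g * pulled ≤ exp (g * pulled)` against it.
    set p : (Fin T → Fin K → ℝ) → ℝ := fun x =>
      Real.exp (-l * noiseSum π ν B k s t x - g * pullCount π k s (t + 1) x) with hp
    have hpm : Measurable p := by
      have h1 := measurable_noiseSum (ν := ν) (k := k) hπ hB.le s t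
      have h2 := measurable_pullCount (T := T) (k := k) hπ s (t + 1)
      have h3 : Measurable fun x : Fin T → Fin K → ℝ => (pullCount π k s (t + 1) x : ℝ) :=
        measurable_from_top.comp h2
      fun_prop
    have hpp : DependsOnPast t p := by
      intro x r y hr
      simp only [hp, dependsOnPast_noiseSum s t x r y hr,
        dependsOnPast_pullCount s (t + 1) t le_rfl x r y hr]
    have hbd : ∀ x, Real.exp (-l * noiseSum π ν B k s (t + 1) x
        - g * pullCount π k s (t + 1) x)
        ≤ p x + (-l * p x) * noise π ν B k t x + (g * p x) * noise π ν B k t x ^ 2 := by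
      intro x
      have hz : -l * noise π ν B k t x ≤ 2 * B * l := by
        have := neg_le_of_abs_le (abs_noise_le (π := π) (ν := ν) (k := k) hB.le t x)
        nlinarith
      have h1 := exp_sub_one_sub_mul_sq_le (by positivity : 0 < 2 * B * l) hz
      have h2 : Real.exp (-l * noise π ν B k t x) ≤ 1 + -l * noise π ν B k t x
          + g * noise π ν B k t x ^ 2 := by
        have h3 : (Real.exp (2 * B * l) - 1 - 2 * B * l) = g * (2 * B) ^ 2 := by
          rw [hg, expRate]; field_simp
        rw [h3] at h1
        have h4 : 0 < (2 * B * l) ^ 2 := by positivity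
        have h5 : Real.exp (-l * noise π ν B k t x) - 1 - -l * noise π ν B k t x
            ≤ g * noise π ν B k t x ^ 2 := by
          refine le_of_mul_le_mul_right (h1.trans (le_of_eq ?_)) h4
          ring
        linarith
      have h6 : Real.exp (-l * noiseSum π ν B k s (t + 1) x - g * pullCount π k s (t + 1) x)
          = p x * Real.exp (-l * noise π ν B k t x) := by
        rw [hp, ← Real.exp_add, noiseSum_succ hst]; ring_nf
      rw [h6]
      calc _ ≤ p x * (1 + -l * noise π ν B k t x + g * noise π ν B k t x ^ 2) := by
            gcongr
        _ = _ := by ring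
    calc _ ≤ ∫⁻ x, ENNReal.ofReal (p x + (-l * p x) * noise π ν B k t x
          + (g * p x) * noise π ν B k t x ^ 2) ∂ν.rewardLaw :=
          lintegral_mono fun x => ENNReal.ofReal_le_ofReal (hbd x)
      _ ≤ ∫⁻ x, ENNReal.ofReal (p x + (g * p x) * pulled π k t x) ∂ν.rewardLaw :=
          lintegral_noise_quadratic_le hπ hν hB.le t hpm (by fun_prop) (by fun_prop) hpp
            (fun x r y hr => by simp only [hpp x r y hr])
            (fun x r y hr => by simp only [hpp x r y hr])
            (fun x => mul_nonneg hg0 (Real.exp_pos _).le)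
            (fun x => (Real.exp_pos _).le.trans (hbd x))
      _ ≤ _ := by
          refine lintegral_mono fun x => ENNReal.ofReal_le_ofReal ?_
          have h7 : p x = Real.exp (-l * noiseSum π ν B k s t x - g * pullCount π k s t x)
              * Real.exp (-(g * pulled π k t x)) := by
            simp only [hp]
            rw [← Real.exp_add, pullCount_succ hst]; push_cast; ring_nf
          have h8 := Real.add_one_le_exp (g * pulled π k t x)
          calc p x + (g * p x) * pulled π k t x
              = Real.exp (-l * noiseSum π ν B k s t x - g * pullCount π k s t x)
              * (Real.exp (-(g * pulled π k t x)) * (g * pulled π k t x + 1)) := by rw [h7]; ring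
            _ ≤ Real.exp (-l * noiseSum π ν B k s t x - g * pullCount π k s t x)
              * (Real.exp (-(g * pulled π k t x)) * Real.exp (g * pulled π k t x)) := by
                gcongr
            _ = _ := by rw [← Real.exp_add (-(g * _))]; simp

end

section

/-! ### Fourth moments of window sums at the selected arm

The selections of an arm are cut into blocks of `H` consecutive ones. A window with at most `H`
selections meets at most two blocks, so its noise is controlled by the largest partial sums of
these blocks. -/

/-- Potential that dominates `O ^ 4`, where `O` is the running maximum of `|M|` and `c` is the
number of increments that are still to come. -/
def maxPotential (M O c : ℝ) : ℝ :=
  27 / 8 * (M ^ 4 + 10 * c * M ^ 2) + (3 * O ^ 4 - 4 * |M| * O ^ 3)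

/-- With `u = |M|`, the polynomial `27 / 8 * u ^ 4 - 4 * u * O ^ 3 + 2 * O ^ 4` has a double root at
`u = 2 * O / 3`; this makes `27 / 8` the least possible factor. -/
theorem pow_le_maxPotential {M O c : ℝ} (hO : 0 ≤ O) (hc : 0 ≤ c) :
    O ^ 4 ≤ maxPotential M O c := by
  unfold maxPotential
  have h1 : M ^ 4 = |M| ^ 4 := by rw [← abs_pow, abs_of_nonneg (by positivity)]
  have h2 : 0 ≤ 10 * c * M ^ 2 := by positivity
  rw [h1]
  set u := |M|
  have hu : 0 ≤ u := abs_nonneg M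
  have h3 : 0 ≤ (u - 2 / 3 * O) ^ 2 * (u ^ 2 + 4 / 3 * (u * O) + 4 / 3 * O ^ 2) := by positivity
  nlinarith

/-- The subgradient inequality for the absolute value; it lets `-4 * |M| * O ^ 3` change by at most
a term linear in the centered increment. -/
theorem abs_add_sign_mul_le (M Y : ℝ) : |M| + Real.sign M * Y ≤ |M + Y| := by
  rcases lt_trichotomy M 0 with h | h | h
  · rw [Real.sign_of_neg h, abs_of_neg h]
    linarith [neg_le_abs (M + Y)]
  · subst h; simp
  · rw [Real.sign_of_pos h, abs_of_pos h]
    linarith [le_abs_self (M + Y)]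

/-- The derivative of `3 * o ^ 4 - 4 * v * o ^ 3` in `o` is `12 * o ^ 2 * (o - v)`, so raising the
running maximum to `v` can only lower the value. -/
theorem max_pow_sub_le {O v : ℝ} (hO : 0 ≤ O) :
    3 * max O v ^ 4 - 4 * v * max O v ^ 3 ≤ 3 * O ^ 4 - 4 * v * O ^ 3 := by
  rcases le_total v O with h | h
  · rw [max_eq_left h]
  · rw [max_eq_right h]
    have : 0 ≤ (v - O) ^ 2 * (v ^ 2 + 2 * (v * O) + 3 * O ^ 2) := by
      have := mul_nonneg (hO.trans h) hO
      positivity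
    nlinarith

/-- A pathwise Doob inequality. The cubic and quartic terms in `Y` are reduced to multiples of `Y ^
2` by `|Y| ≤ 2 * B`, so that a bound on the second moment suffices. -/
theorem maxPotential_add_le {M O c Y B : ℝ} (hO : 0 ≤ O) (hY : |Y| ≤ 2 * B) :
    maxPotential (M + Y) (max O |M + Y|) c ≤ maxPotential M O c
      + (27 / 8 * (4 * M ^ 3 + 20 * c * M) - 4 * O ^ 3 * Real.sign M) * Y
      + 27 / 8 * (10 * M ^ 2 + 8 * B ^ 2 + 10 * c) * Y ^ 2 := by
  unfold maxPotential
  have h1 := max_pow_sub_le (v := |M + Y|) hO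
  have h2 : 4 * O ^ 3 * (|M| + Real.sign M * Y) ≤ 4 * O ^ 3 * |M + Y| :=
    mul_le_mul_of_nonneg_left (abs_add_sign_mul_le M Y) (by positivity)
  have hY2 : Y ^ 2 ≤ 4 * B ^ 2 := by
    rw [← sq_abs]; nlinarith [abs_nonneg Y]
  have h3 : 4 * (M * Y) ≤ 4 * M ^ 2 + 4 * B ^ 2 := by
    nlinarith [sq_nonneg (2 * M - Y)]
  have h4 : (M + Y) ^ 4 ≤ M ^ 4 + 4 * M ^ 3 * Y + (10 * M ^ 2 + 8 * B ^ 2) * Y ^ 2 := by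
    nlinarith [mul_le_mul_of_nonneg_right h3 (sq_nonneg Y),
      mul_le_mul_of_nonneg_right hY2 (sq_nonneg Y)]
  nlinarith

variable {K T : ℕ} {π : Policy K} {ν : Environment K T} {B : ℝ} {k : Fin K} {H : ℕ}

/-- `1` if arm `k` is selected at slot `s` and this selection belongs to block `b`. -/
def blockPulled (π : Policy K) (k : Fin K) (H b s : ℕ) (x : Fin T → Fin K → ℝ) : ℕ :=
  if pullCount π k 0 s x / H = b then pulled π k s x else 0

/-- The noise of slot `s` if the slot belongs to block `b`. -/
def blockNoise (π : Policy K) (ν : Environment K T) (B : ℝ) (k : Fin K) (H b s : ℕ)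
    (x : Fin T → Fin K → ℝ) : ℝ :=
  if pullCount π k 0 s x / H = b then noise π ν B k s x else 0

/-- The number of selections in block `b` before slot `t`. -/
def blockCount (π : Policy K) (k : Fin K) (H b t : ℕ) (x : Fin T → Fin K → ℝ) : ℕ :=
  ∑ s ∈ Finset.range t, blockPulled π k H b s x

/-- The noise in block `b` before slot `t`. -/
def blockSum (π : Policy K) (ν : Environment K T) (B : ℝ) (k : Fin K) (H b t : ℕ)
    (x : Fin T → Fin K → ℝ) : ℝ :=
  ∑ s ∈ Finset.range t, blockNoise π ν B k H b s x

/-- The largest absolute value of `blockSum` up to slot `t`. -/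
def blockMax (π : Policy K) (ν : Environment K T) (B : ℝ) (k : Fin K) (H b : ℕ) :
    ℕ → (Fin T → Fin K → ℝ) → ℝ
  | 0, _ => 0
  | t + 1, x => max (blockMax π ν B k H b t x) |blockSum π ν B k H b (t + 1) x|

theorem blockMax_nonneg (b t : ℕ) (x : Fin T → Fin K → ℝ) : 0 ≤ blockMax π ν B k H b t x := by
  induction t with
  | zero => exact le_rfl
  | succ t ih => exact le_max_of_le_left ih

theorem abs_blockSum_le_blockMax (b : ℕ) {s t : ℕ} (hst : s ≤ t) (x : Fin T → Fin K → ℝ) :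
    |blockSum π ν B k H b s x| ≤ blockMax π ν B k H b t x := by
  induction t with
  | zero =>
    obtain rfl : s = 0 := by omega
    simp [blockSum, blockMax]
  | succ t ih =>
    rcases Nat.lt_or_ge s (t + 1) with h | h
    · exact le_max_of_le_left (ih (by omega))
    · obtain rfl : s = t + 1 := by omega
      exact le_max_right _ _

/-- Block `b` opens only after `b * H` selections; hence it cannot hold more than `H` of them. -/
theorem blockCount_le_sub (b t : ℕ) (x : Fin T → Fin K → ℝ) :
    blockCount π k H b t x ≤ pullCount π k 0 t x - b * H := by
  induction t with
  | zero => simp [blockCount]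
  | succ t ih =>
    rw [blockCount, Finset.sum_range_succ, ← blockCount, pullCount_succ (Nat.zero_le t), blockPulled]
    split_ifs with h
    · have : b * H ≤ pullCount π k 0 t x := by
        rw [← h]; exact Nat.div_mul_le_self _ _
      omega
    · omega

theorem blockCount_le (hH : 0 < H) (b t : ℕ) (x : Fin T → Fin K → ℝ) :
    blockCount π k H b t x ≤ H := by
  induction t with
  | zero => simp [blockCount]
  | succ t ih =>
    rw [blockCount, Finset.sum_range_succ, ← blockCount, blockPulled]
    split_ifs with h
    · have h1 := blockCount_le_sub (π := π) (k := k) (H := H) b t x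
      have h2 : pullCount π k 0 t x < (b + 1) * H := by
        exact (Nat.div_lt_iff_lt_mul hH).1 (by omega)
      have h3 := pulled_le_one (π := π) (k := k) t x
      rw [Nat.add_mul, one_mul] at h2
      omega
    · omega

theorem sum_blockPulled_le (n s : ℕ) (x : Fin T → Fin K → ℝ) :
    ∑ b ∈ Finset.range n, blockPulled π k H b s x ≤ pulled π k s x := by
  unfold blockPulled
  rw [Finset.sum_ite_eq]
  split_ifs <;> simp

theorem sum_blockCount_le (n t : ℕ) (x : Fin T → Fin K → ℝ) :
    ∑ b ∈ Finset.range n, blockCount π k H b t x ≤ pullCount π k 0 t x := by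
  unfold blockCount pullCount
  rw [Finset.sum_comm, Nat.Ico_zero_eq_range]
  exact Finset.sum_le_sum fun s _ => sum_blockPulled_le n s x

section Measurability

theorem measurable_blockPulled (hπ : ∀ t, Measurable (π t)) (b s : ℕ) :
    Measurable (blockPulled (T := T) π k H b s) :=
  Measurable.ite (((measurable_from_top (f := fun n : ℕ => n / H)).comp
    (measurable_pullCount hπ 0 s)) (measurableSet_singleton b)) (measurable_pulled hπ s)
    measurable_const

theorem measurable_blockNoise (hπ : ∀ t, Measurable (π t)) (hB : 0 ≤ B) (b s : ℕ) :
    Measurable (blockNoise π ν B k H b s) :=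
  Measurable.ite (((measurable_from_top (f := fun n : ℕ => n / H)).comp
    (measurable_pullCount hπ 0 s)) (measurableSet_singleton b)) (measurable_noise hπ hB s)
    measurable_const

theorem measurable_blockCount (hπ : ∀ t, Measurable (π t)) (b t : ℕ) :
    Measurable (blockCount (T := T) π k H b t) :=
  Finset.measurable_fun_sum _ fun s _ => measurable_blockPulled hπ b s

theorem measurable_blockSum (hπ : ∀ t, Measurable (π t)) (hB : 0 ≤ B) (b t : ℕ) :
    Measurable (blockSum π ν B k H b t) :=
  Finset.measurable_fun_sum _ fun s _ => measurable_blockNoise hπ hB b s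

theorem measurable_blockMax (hπ : ∀ t, Measurable (π t)) (hB : 0 ≤ B) (b t : ℕ) :
    Measurable (blockMax π ν B k H b t) := by
  induction t with
  | zero => exact measurable_const
  | succ t ih =>
    have := measurable_blockSum (ν := ν) (k := k) (H := H) hπ hB b (t + 1)
    exact ih.max (measurable_norm.comp this)

theorem dependsOnPast_blockPulled (b s : ℕ) :
    DependsOnPast s (blockPulled (T := T) π k H b s) := by
  intro x r y hr
  simp only [blockPulled, dependsOnPast_pullCount 0 s s (by omega) x r y hr,
    dependsOnPast_pulled s x r y hr]

theorem dependsOnPast_blockNoise (b s : ℕ) :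
    DependsOnPast (s + 1) (blockNoise π ν B k H b s) := by
  intro x r y hr
  simp only [blockNoise, dependsOnPast_pullCount 0 s (s + 1) (by omega) x r y hr,
    dependsOnPast_noise s x r y hr]

theorem dependsOnPast_blockCount (b t : ℕ) :
    DependsOnPast t (blockCount (T := T) π k H b t) := by
  intro x r y hr
  refine Finset.sum_congr rfl fun i hi => ?_
  rw [Finset.mem_range] at hi
  exact (dependsOnPast_blockPulled b i).mono (by omega) x r y hr

theorem dependsOnPast_blockSum (b t : ℕ) : DependsOnPast t (blockSum π ν B k H b t) := by
  intro x r y hr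
  refine Finset.sum_congr rfl fun i hi => ?_
  rw [Finset.mem_range] at hi
  exact (dependsOnPast_blockNoise b i).mono (by omega) x r y hr

theorem dependsOnPast_blockMax (b t : ℕ) : DependsOnPast t (blockMax π ν B k H b t) := by
  induction t with
  | zero => intro x r y _; rfl
  | succ t ih =>
    intro x r y hr
    simp only [blockMax, ih.mono (Nat.le_succ t) x r y hr, dependsOnPast_blockSum b (t + 1) x r y hr]

end Measurability

theorem lintegral_maxPotential_le (hπ : ∀ t, Measurable (π t)) (hν : ν.HeavyTailed)
    (hB : 0 ≤ B) (hH : 0 < H) (b t : ℕ) :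
    ∫⁻ x, ENNReal.ofReal (maxPotential (blockSum π ν B k H b t x) (blockMax π ν B k H b t x)
        (H - blockCount π k H b t x)) ∂ν.rewardLaw
      ≤ ∫⁻ x, ENNReal.ofReal (27 / 8 * (8 * B ^ 2 + 10 * H) * blockCount π k H b t x)
        ∂ν.rewardLaw := by
  induction t with
  | zero => simp [blockSum, blockMax, blockCount, maxPotential]
  | succ t ih =>
    set M := blockSum π ν B k H b t with hM
    set O := blockMax π ν B k H b t with hO
    set w : (Fin T → Fin K → ℝ) → ℝ := fun x => if pullCount π k 0 t x / H = b then 1 else 0 with hw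
    -- The number of selections left after slot `t`; it is known before the reward of slot `t` is
    -- drawn.
    set c : (Fin T → Fin K → ℝ) → ℝ := fun x => H - (blockCount π k H b t x
      + blockPulled π k H b t x) with hc
    have hMm : Measurable M := measurable_blockSum hπ hB b t
    have hOm : Measurable O := measurable_blockMax hπ hB b t
    have hwm : Measurable w := Measurable.ite
      (((measurable_from_top (f := fun n : ℕ => n / H)).comp (measurable_pullCount hπ 0 t))
        (measurableSet_singleton b)) measurable_const measurable_const
    have hjm : Measurable fun x : Fin T → Fin K → ℝ => (blockCount π k H b t x : ℝ) :=
      measurable_from_top.comp (measurable_blockCount hπ b t)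
    have ham : Measurable fun x : Fin T → Fin K → ℝ => (blockPulled π k H b t x : ℝ) :=
      measurable_from_top.comp (measurable_blockPulled hπ b t)
    have hcm : Measurable c := by fun_prop
    have hsm : Measurable fun x => Real.sign (M x) := by
      have : Measurable Real.sign := by
        unfold Real.sign
        exact Measurable.ite measurableSet_Iio measurable_const
          (Measurable.ite measurableSet_Ioi measurable_const measurable_const)
      exact this.comp hMm
    have hMp : DependsOnPast t M := dependsOnPast_blockSum b t
    have hOp : DependsOnPast t O := dependsOnPast_blockMax b t
    have hwp : DependsOnPast t w := fun x r y hr => by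
      simp only [hw, dependsOnPast_pullCount 0 t t (by omega) x r y hr]
    have hcp : DependsOnPast t c := fun x r y hr => by
      simp only [hc, dependsOnPast_blockCount b t x r y hr, dependsOnPast_blockPulled b t x r y hr]
    have hc0 : ∀ x, 0 ≤ c x := fun x => by
      have h1 := blockCount_le (π := π) (k := k) hH b (t + 1) x
      rw [blockCount, Finset.sum_range_succ, ← blockCount] at h1
      have h2 : ((blockCount π k H b t x + blockPulled π k H b t x : ℕ) : ℝ) ≤ H :=
        Nat.cast_le.2 h1
      push_cast at h2
      simp only [hc]
      linarith
    have hO0 : ∀ x, 0 ≤ O x := blockMax_nonneg b t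
    have hww : ∀ x, w x * w x = w x := fun x => by simp only [hw]; split_ifs <;> simp
    have hwa : ∀ x, w x * pulled π k t x = blockPulled π k H b t x := fun x => by
      simp only [hw, blockPulled]; split_ifs <;> simp
    have hwn : ∀ x, blockNoise π ν B k H b t x = w x * noise π ν B k t x := fun x => by
      simp only [hw, blockNoise]; split_ifs <;> simp
    set p : (Fin T → Fin K → ℝ) → ℝ := fun x => maxPotential (M x) (O x) (c x) with hp
    set q : (Fin T → Fin K → ℝ) → ℝ := fun x =>
      (27 / 8 * (4 * M x ^ 3 + 20 * c x * M x) - 4 * O x ^ 3 * Real.sign (M x)) * w x with hq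
    set r : (Fin T → Fin K → ℝ) → ℝ := fun x =>
      27 / 8 * (10 * M x ^ 2 + 8 * B ^ 2 + 10 * c x) * w x with hr
    have habs : Measurable fun x => |M x| := measurable_norm.comp hMm
    have hw0 : ∀ x, 0 ≤ w x := fun x => by simp only [hw]; split_ifs <;> simp
    have hbd : ∀ x, maxPotential (blockSum π ν B k H b (t + 1) x) (blockMax π ν B k H b (t + 1) x)
        (H - blockCount π k H b (t + 1) x)
        ≤ p x + q x * noise π ν B k t x + r x * noise π ν B k t x ^ 2 := by
      intro x
      have hS : blockSum π ν B k H b (t + 1) x = M x + w x * noise π ν B k t x := by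
        rw [blockSum, Finset.sum_range_succ, hwn]; rfl
      have hC : ((H : ℝ) - (blockCount π k H b (t + 1) x : ℕ)) = c x := by
        rw [blockCount, Finset.sum_range_succ, ← blockCount]; simp only [hc]; push_cast; ring
      have hY : |w x * noise π ν B k t x| ≤ 2 * B := by
        rw [← hwn, blockNoise]
        split_ifs
        · exact abs_noise_le hB t x
        · simpa using hB
      rw [hC, blockMax, hS]
      refine (maxPotential_add_le (hO0 x) hY).trans (le_of_eq ?_)
      simp only [hp, hq, hr, mul_pow]
      rw [sq (w x), hww]
      ring
    have hpot0 : ∀ x, 0 ≤ maxPotential (blockSum π ν B k H b (t + 1) x)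
        (blockMax π ν B k H b (t + 1) x) (H - blockCount π k H b (t + 1) x) := fun x =>
      (pow_nonneg (blockMax_nonneg b (t + 1) x) 4).trans
        (pow_le_maxPotential (blockMax_nonneg b (t + 1) x)
          (sub_nonneg.2 (Nat.cast_le.2 (blockCount_le hH b (t + 1) x))))
    have hpot0' : ∀ x, 0 ≤ maxPotential (M x) (O x) (H - blockCount π k H b t x) := fun x =>
      (pow_nonneg (hO0 x) 4).trans
        (pow_le_maxPotential (hO0 x) (sub_nonneg.2 (Nat.cast_le.2 (blockCount_le hH b t x))))
    calc _ ≤ ∫⁻ x, ENNReal.ofReal (p x + q x * noise π ν B k t x + r x * noise π ν B k t x ^ 2)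
          ∂ν.rewardLaw := lintegral_mono fun x => ENNReal.ofReal_le_ofReal (hbd x)
      _ ≤ ∫⁻ x, ENNReal.ofReal (p x + r x * pulled π k t x) ∂ν.rewardLaw := by
          refine lintegral_noise_quadratic_le hπ hν hB t ?_ (by fun_prop) (by fun_prop)
            (fun x i y hi => ?_) (fun x i y hi => ?_) (fun x i y hi => ?_) (fun x => ?_)
            (fun x => (hpot0 x).trans (hbd x))
          · simp only [hp, maxPotential]; fun_prop
          · simp only [hp, hMp x i y hi, hOp x i y hi, hcp x i y hi]
          · simp only [hq, hMp x i y hi, hOp x i y hi, hcp x i y hi, hwp x i y hi]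
          · simp only [hr, hMp x i y hi, hcp x i y hi, hwp x i y hi]
          · have := hc0 x
            have := hw0 x
            positivity
      _ ≤ ∫⁻ x, (ENNReal.ofReal (maxPotential (M x) (O x) (H - blockCount π k H b t x))
            + ENNReal.ofReal (27 / 8 * (8 * B ^ 2 + 10 * H) * blockPulled π k H b t x))
            ∂ν.rewardLaw := by
          refine lintegral_mono fun x => ?_
          rw [← ENNReal.ofReal_add (hpot0' x) (by positivity)]
          apply ENNReal.ofReal_le_ofReal
          have h1 : r x * pulled π k t x = 27 / 8 * (10 * M x ^ 2 + 8 * B ^ 2 + 10 * c x)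
              * blockPulled π k H b t x := by
            rw [← hwa]; simp only [hr]; ring
          rw [h1]
          have h2 : blockPulled π k H b t x = 0 ∨ blockPulled π k H b t x = 1 := by
            have := pulled_le_one (π := π) (k := k) t x
            unfold blockPulled
            split_ifs <;> omega
          have h3 : (0 : ℝ) ≤ blockCount π k H b t x := by positivity
          simp only [hp, hc, maxPotential]
          -- A selection lowers the remaining count by one, which pays for the drift `10 * M ^ 2` of
          -- the fourth power; only `8 * B ^ 2 + 10 * H` per selection is left.
          rcases h2 with h2 | h2 <;> rw [h2] <;> push_cast
          · simp
          · nlinarith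
      _ ≤ _ := by
          rw [lintegral_add_right _ (by fun_prop)]
          refine (add_le_add_left ih _).trans (le_of_eq ?_)
          rw [← lintegral_add_right _ (by fun_prop)]
          refine lintegral_congr fun x => ?_
          rw [← ENNReal.ofReal_add (by positivity) (by positivity)]
          congr 1
          rw [blockCount, blockCount, Finset.sum_range_succ]
          push_cast
          ring

theorem lintegral_blockMax_pow_le (hπ : ∀ t, Measurable (π t)) (hν : ν.HeavyTailed)
    (hB : 0 ≤ B) (hH : 0 < H) (b t : ℕ) :
    ∫⁻ x, ENNReal.ofReal (blockMax π ν B k H b t x ^ 4) ∂ν.rewardLaw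
      ≤ ∫⁻ x, ENNReal.ofReal (27 / 8 * (8 * B ^ 2 + 10 * H) * blockCount π k H b t x)
        ∂ν.rewardLaw := by
  refine le_trans (lintegral_mono fun x => ENNReal.ofReal_le_ofReal ?_)
    (lintegral_maxPotential_le hπ hν hB hH b t)
  exact pow_le_maxPotential (blockMax_nonneg b t x)
    (sub_nonneg.2 (Nat.cast_le.2 (blockCount_le hH b t x)))

end

/-! ### Window sums compared with block maxima -/

section

variable {K T : ℕ} {π : Policy K} {ν : Environment K T} {B : ℝ} {k : Fin K} {H : ℕ}

theorem pullCount_mono {s t u v : ℕ} (h : u ≤ s) (h' : t ≤ v) (x : Fin T → Fin K → ℝ) :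
    pullCount π k s t x ≤ pullCount π k u v x :=
  Finset.sum_le_sum_of_subset (Finset.Ico_subset_Ico h h')

theorem pullCount_add {s t u : ℕ} (h : s ≤ t) (h' : t ≤ u) (x : Fin T → Fin K → ℝ) :
    pullCount π k s t x + pullCount π k t u x = pullCount π k s u x :=
  Finset.sum_Ico_consecutive _ h h'

theorem pullCount_le_sub (s t : ℕ) (x : Fin T → Fin K → ℝ) : pullCount π k s t x ≤ t - s := by
  calc pullCount π k s t x ≤ ∑ _r ∈ Finset.Ico s t, 1 :=
        Finset.sum_le_sum fun r _ => pulled_le_one r x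
    _ = t - s := by simp

/-- The blocks that a window ending at slot `t` may meet. -/
def nearBlocks (π : Policy K) (k : Fin K) (H t : ℕ) (x : Fin T → Fin K → ℝ) : Finset ℕ :=
  {b ∈ Finset.range (T + 1) | b = pullCount π k 0 t x / H ∨ b + 1 = pullCount π k 0 t x / H}

theorem card_nearBlocks_le (t : ℕ) (x : Fin T → Fin K → ℝ) :
    (nearBlocks π k H t x).card ≤ 2 := by
  refine (Finset.card_le_card (t := {pullCount π k 0 t x / H, pullCount π k 0 t x / H - 1})
    fun b hb => ?_).trans Finset.card_le_two
  simp only [nearBlocks, Finset.mem_filter] at hb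
  simp only [Finset.mem_insert, Finset.mem_singleton]
  omega

/-- Inside the window the running count of selections varies by at most `H`, so its quotient by `H`
is the one at slot `t` or the preceding integer. -/
theorem noiseSum_eq_sum_blockSum_sub (hH : 0 < H) {s t : ℕ} (hst : s ≤ t) (htT : t ≤ T)
    (x : Fin T → Fin K → ℝ) (hn : pullCount π k s t x ≤ H) :
    noiseSum π ν B k s t x = ∑ b ∈ nearBlocks π k H t x,
      (blockSum π ν B k H b t x - blockSum π ν B k H b s x) := by
  have h1 : ∀ b, blockSum π ν B k H b t x - blockSum π ν B k H b s x
      = ∑ r ∈ Finset.Ico s t, blockNoise π ν B k H b r x := fun b => by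
    rw [Finset.sum_Ico_eq_sub _ hst]; rfl
  simp only [h1]
  rw [Finset.sum_comm]
  refine Finset.sum_congr rfl fun r hr => ?_
  rw [Finset.mem_Ico] at hr
  unfold blockNoise
  rw [Finset.sum_ite_eq, if_pos]
  simp only [nearBlocks, Finset.mem_filter, Finset.mem_range]
  have h2 := pullCount_add (π := π) (k := k) (Nat.zero_le s) hst x
  have h3 := pullCount_mono (π := π) (k := k) le_rfl hr.1 (u := 0) x
  have h4 := pullCount_mono (π := π) (k := k) le_rfl hr.2.le (u := 0) x
  have h5 := pullCount_le_sub (π := π) (k := k) 0 r x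
  have h6 : pullCount π k 0 r x / H ≤ pullCount π k 0 r x := Nat.div_le_self _ _
  refine ⟨by omega, ?_⟩
  have h7 : pullCount π k 0 r x / H ≤ pullCount π k 0 t x / H := Nat.div_le_div_right h4
  have h8 : pullCount π k 0 t x / H ≤ (pullCount π k 0 r x + H) / H :=
    Nat.div_le_div_right (by omega)
  rw [Nat.add_div_right _ hH] at h8
  omega

/-- The constant is `8 * 2 ^ 4`: the power mean inequality for two blocks, and a difference of two
partial sums in each. -/
theorem noiseSum_pow_le (hH : 0 < H) {s t : ℕ} (hst : s ≤ t) (htT : t ≤ T)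
    (x : Fin T → Fin K → ℝ) (hn : pullCount π k s t x ≤ H) :
    noiseSum π ν B k s t x ^ 4
      ≤ 128 * ∑ b ∈ nearBlocks π k H t x, blockMax π ν B k H b T x ^ 4 := by
  have h1 : |noiseSum π ν B k s t x| ≤ ∑ b ∈ nearBlocks π k H t x,
      2 * blockMax π ν B k H b T x := by
    rw [noiseSum_eq_sum_blockSum_sub hH hst htT x hn]
    refine (Finset.abs_sum_le_sum_abs _ _).trans (Finset.sum_le_sum fun b _ => ?_)
    refine (abs_sub _ _).trans ?_
    linarith [abs_blockSum_le_blockMax (π := π) (ν := ν) (B := B) (k := k) (H := H) b htT x,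
      abs_blockSum_le_blockMax (π := π) (ν := ν) (B := B) (k := k) (H := H) b (hst.trans htT) x]
  set S := nearBlocks π k H t x with hS
  have h2 : (∑ b ∈ S, 2 * blockMax π ν B k H b T x) ^ 4
      ≤ 8 * ∑ b ∈ S, (2 * blockMax π ν B k H b T x) ^ 4 := by
    have hf : ∀ b ∈ S, 0 ≤ 2 * blockMax π ν B k H b T x := fun b _ =>
      mul_nonneg zero_le_two (blockMax_nonneg b T x)
    rcases S.eq_empty_or_nonempty with h | h
    · simp [h]
    · have h3 := pow_sum_div_card_le_sum_pow hf 3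
      have h4 : (0 : ℝ) < S.card := Nat.cast_pos.2 h.card_pos
      have h5 : (S.card : ℝ) ≤ 2 := by exact_mod_cast card_nearBlocks_le t x
      rw [div_le_iff₀ (by positivity)] at h3
      refine h3.trans ?_
      rw [mul_comm]
      have h6 : (S.card : ℝ) ^ 3 ≤ 8 := (pow_le_pow_left₀ h4.le h5 3).trans (by norm_num)
      exact mul_le_mul_of_nonneg_right h6 (Finset.sum_nonneg fun b hb => pow_nonneg (hf b hb) 4)
  calc noiseSum π ν B k s t x ^ 4 = |noiseSum π ν B k s t x| ^ 4 := by
        rw [← abs_pow, abs_of_nonneg (by positivity)]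
    _ ≤ _ := pow_le_pow_left₀ (abs_nonneg _) h1 4
    _ ≤ _ := h2
    _ = _ := by
        simp only [mul_pow, ← Finset.mul_sum]
        ring

/-- The maximum of block `b` is charged only by selections that lie in block `b` or `b + 1`, hence
at most `2 * H` times. -/
theorem sum_noiseSum_pow_le (hH : 0 < H) (τ : ℕ) (x : Fin T → Fin K → ℝ) :
    ∑ t ∈ Finset.range T, (if pullCount π k (t - τ) t x ≤ H then
      (pulled π k t x : ℝ) * noiseSum π ν B k (t - τ) t x ^ 4 else 0)
      ≤ 256 * H * ∑ b ∈ Finset.range (T + 1), blockMax π ν B k H b T x ^ 4 := by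
  have h1 : ∀ t ∈ Finset.range T, (if pullCount π k (t - τ) t x ≤ H then
      (pulled π k t x : ℝ) * noiseSum π ν B k (t - τ) t x ^ 4 else 0)
      ≤ ∑ b ∈ Finset.range (T + 1), 128 * blockMax π ν B k H b T x ^ 4
        * ((blockPulled π k H b t x : ℝ) + blockPulled π k H (b + 1) t x) := by
    intro t ht
    rw [Finset.mem_range] at ht
    split_ifs with hn
    · calc _ ≤ (pulled π k t x : ℝ)
            * (128 * ∑ b ∈ nearBlocks π k H t x, blockMax π ν B k H b T x ^ 4) := by
            gcongr
            exact noiseSum_pow_le hH (Nat.sub_le _ _) ht.le x hn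
        _ = ∑ b ∈ nearBlocks π k H t x, 128 * blockMax π ν B k H b T x ^ 4 * pulled π k t x := by
            rw [Finset.mul_sum, Finset.mul_sum]
            exact Finset.sum_congr rfl fun b _ => by ring
        _ ≤ ∑ b ∈ nearBlocks π k H t x, 128 * blockMax π ν B k H b T x ^ 4
            * ((blockPulled π k H b t x : ℝ) + blockPulled π k H (b + 1) t x) := by
            refine Finset.sum_le_sum fun b hb => ?_
            gcongr
            simp only [nearBlocks, Finset.mem_filter] at hb
            rcases hb.2 with h | h
            · have : blockPulled π k H b t x = pulled π k t x := by
                rw [blockPulled, if_pos h.symm]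
              rw [this]; simp
            · have : blockPulled π k H (b + 1) t x = pulled π k t x := by
                rw [blockPulled, if_pos h.symm]
              rw [this]; simp
        _ ≤ _ := Finset.sum_le_sum_of_subset_of_nonneg (Finset.filter_subset _ _)
            fun b _ _ => by positivity
    · exact Finset.sum_nonneg fun b _ => by positivity
  refine (Finset.sum_le_sum h1).trans ?_
  rw [Finset.sum_comm, Finset.mul_sum]
  refine Finset.sum_le_sum fun b _ => ?_
  rw [← Finset.mul_sum, Finset.sum_add_distrib]
  have h2 : ∀ b, ∑ t ∈ Finset.range T, (blockPulled π k H b t x : ℝ) ≤ H := fun b => by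
    have := blockCount_le (π := π) (k := k) hH b T x
    rw [blockCount] at this
    exact_mod_cast this
  have h3 : 0 ≤ 128 * blockMax π ν B k H b T x ^ 4 := by positivity
  nlinarith [mul_le_mul_of_nonneg_left (add_le_add (h2 b) (h2 (b + 1))) h3]

theorem sum_pulled_eq_one {t : ℕ} (ht : t < T) (x : Fin T → Fin K → ℝ) :
    ∑ k, pulled π k t x = 1 := by
  simp [pulled, ht]

theorem sum_pullCount_le (x : Fin T → Fin K → ℝ) :
    ∑ k, pullCount π k 0 T x ≤ T := by
  unfold pullCount
  rw [Finset.sum_comm]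
  refine (Finset.sum_le_sum (g := fun _ => 1) fun t ht => ?_).trans (by simp)
  rw [Finset.mem_Ico] at ht
  exact (sum_pulled_eq_one ht.2 x).le

/-- Expected fourth powers of the window sums of the selected arms, over all slots at which the
window holds at most `H` samples of the selected arm. -/
theorem lintegral_sum_noiseSum_pow_le (hπ : ∀ t, Measurable (π t)) (hν : ν.HeavyTailed)
    (hB : 0 ≤ B) (hH : 0 < H) (τ : ℕ) :
    ∫⁻ x, ENNReal.ofReal (∑ k, ∑ t ∈ Finset.range T, (if pullCount π k (t - τ) t x ≤ H then
      (pulled π k t x : ℝ) * noiseSum π ν B k (t - τ) t x ^ 4 else 0)) ∂ν.rewardLaw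
      ≤ ENNReal.ofReal (256 * H * (27 / 8 * (8 * B ^ 2 + 10 * H)) * T) := by
  have hOm : ∀ k b, Measurable fun x => ENNReal.ofReal (blockMax π ν B k H b T x ^ 4) :=
    fun k b => by
      have := measurable_blockMax (ν := ν) (k := k) (H := H) hπ hB b T
      fun_prop
  have hjm : ∀ k b, Measurable fun x : Fin T → Fin K → ℝ =>
      ENNReal.ofReal (27 / 8 * (8 * B ^ 2 + 10 * H) * blockCount π k H b T x) :=
    fun k b => by
      have : Measurable fun x : Fin T → Fin K → ℝ => (blockCount π k H b T x : ℝ) :=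
        measurable_from_top.comp (measurable_blockCount hπ b T)
      fun_prop
  calc _ ≤ ∫⁻ x, ENNReal.ofReal (256 * H) * ∑ k, ∑ b ∈ Finset.range (T + 1),
        ENNReal.ofReal (blockMax π ν B k H b T x ^ 4) ∂ν.rewardLaw := by
        refine lintegral_mono fun x => ?_
        have h0 : ∀ k b, 0 ≤ blockMax π ν B k H b T x ^ 4 := fun k b => by positivity
        simp only [← ENNReal.ofReal_sum_of_nonneg fun b _ => h0 _ b]
        rw [← ENNReal.ofReal_sum_of_nonneg fun k _ => Finset.sum_nonneg fun b _ => h0 k b,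
          ← ENNReal.ofReal_mul (by positivity)]
        apply ENNReal.ofReal_le_ofReal
        rw [Finset.mul_sum]
        exact Finset.sum_le_sum fun k _ => sum_noiseSum_pow_le hH τ x
    _ = ENNReal.ofReal (256 * H) * ∑ k, ∑ b ∈ Finset.range (T + 1),
        ∫⁻ x, ENNReal.ofReal (blockMax π ν B k H b T x ^ 4) ∂ν.rewardLaw := by
        rw [lintegral_const_mul _ (by fun_prop), lintegral_finsetSum _ (fun k _ => by fun_prop)]
        congr 1
        exact Finset.sum_congr rfl fun k _ => lintegral_finsetSum _ fun b _ => hOm k b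
    _ ≤ ENNReal.ofReal (256 * H) * ∑ k, ∑ b ∈ Finset.range (T + 1),
        ∫⁻ x, ENNReal.ofReal (27 / 8 * (8 * B ^ 2 + 10 * H) * blockCount π k H b T x)
          ∂ν.rewardLaw := by
        refine mul_le_mul_right (Finset.sum_le_sum fun k _ => Finset.sum_le_sum fun b _ => ?_) _
        exact lintegral_blockMax_pow_le hπ hν hB hH b T
    _ = ENNReal.ofReal (256 * H) * ∫⁻ x, ∑ k, ∑ b ∈ Finset.range (T + 1),
        ENNReal.ofReal (27 / 8 * (8 * B ^ 2 + 10 * H) * blockCount π k H b T x)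
          ∂ν.rewardLaw := by
        rw [lintegral_finsetSum _ (fun k _ => by fun_prop)]
        congr 1
        exact Finset.sum_congr rfl fun k _ => (lintegral_finsetSum _ fun b _ => hjm k b).symm
    _ ≤ ENNReal.ofReal (256 * H) * ∫⁻ _x : Fin T → Fin K → ℝ,
        ENNReal.ofReal (27 / 8 * (8 * B ^ 2 + 10 * H) * T) ∂ν.rewardLaw := by
        gcongr with x
        have h0 : ∀ k b, 0 ≤ 27 / 8 * (8 * B ^ 2 + 10 * H) * (blockCount π k H b T x : ℝ) :=
          fun k b => by positivity
        simp only [← ENNReal.ofReal_sum_of_nonneg fun b _ => h0 _ b]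
        rw [← ENNReal.ofReal_sum_of_nonneg fun k _ => Finset.sum_nonneg fun b _ => h0 k b]
        apply ENNReal.ofReal_le_ofReal
        simp only [← Finset.mul_sum]
        gcongr
        -- One selection per slot: this is where a factor `K` is avoided.
        have h1 : ∑ k, ∑ b ∈ Finset.range (T + 1), blockCount π k H b T x ≤ T :=
          (Finset.sum_le_sum fun k _ => sum_blockCount_le (T + 1) T x).trans (sum_pullCount_le x)
        exact_mod_cast h1
    _ = _ := by
        rw [lintegral_const, measure_univ, mul_one, ← ENNReal.ofReal_mul (by positivity)]
        congr 1
        ring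

end

section

/-! ### Geometric sums -/

/-- A bump function with geometric decay at `0` and at `∞`. -/
def bump (y : ℝ) : ℝ := y / (1 + y) ^ 2

/-- `bump` is dominated by the increments of `z / (1 + z)` along a geometric progression, and these
telescope. The bound is uniform in `y` and `n`. -/
theorem sum_bump_le {q y : ℝ} (hq : 1 < q) (hy : 0 < y) (n : ℕ) :
    ∑ l ∈ Finset.range n, bump (q ^ l * y) ≤ q / (q - 1) := by
  have key : ∀ z : ℝ, 0 < z →
      bump z ≤ q / (q - 1) * (q * z / (1 + q * z) - z / (1 + z)) := by
    intro z hz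
    have h1 : 0 < q - 1 := by linarith
    have h2 : 0 < 1 + q * z := by positivity
    have h3 : q / (q - 1) * (q * z / (1 + q * z) - z / (1 + z))
        = z / ((1 + z) * ((1 + q * z) / q)) := by
      field_simp
      ring
    rw [h3, bump, sq]
    gcongr
    rw [div_le_iff₀ (by positivity)]
    nlinarith
  have hs : ∑ l ∈ Finset.range n, bump (q ^ l * y) ≤ ∑ l ∈ Finset.range n,
      q / (q - 1) * (q ^ (l + 1) * y / (1 + q ^ (l + 1) * y) - q ^ l * y / (1 + q ^ l * y)) := by
    refine Finset.sum_le_sum fun l _ => ?_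
    have := key (q ^ l * y) (by positivity)
    rwa [← mul_assoc, ← pow_succ'] at this
  refine hs.trans ?_
  rw [← Finset.mul_sum, Finset.sum_range_sub (fun l => q ^ l * y / (1 + q ^ l * y))]
  have h1 : 0 ≤ q / (q - 1) := div_nonneg (by linarith) (by linarith)
  have h2 : q ^ n * y / (1 + q ^ n * y) ≤ 1 := by
    rw [div_le_one (by positivity)]; linarith
  have h3 : 0 ≤ q ^ 0 * y / (1 + q ^ 0 * y) := by positivity
  exact (mul_le_mul_of_nonneg_left (by linarith) h1).trans (mul_one _).le

theorem inv_sq_mul_le_bump {Q ρ e : ℝ} (hQ : 0 < Q) (hρ : 0 < ρ) (h1 : e ≤ 1)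
    (h2 : e ≤ Q ^ 4 / ρ ^ 4) : e / Q ^ 2 ≤ 4 * bump (Q * ρ⁻¹) / ρ ^ 2 := by
  set y := Q * ρ⁻¹ with hy
  have hQy : Q = y * ρ := by rw [hy]; field_simp
  have hy0 : 0 < y := by positivity
  have h3 : e ≤ y ^ 4 := by
    refine h2.trans (le_of_eq ?_); rw [hQy]; field_simp
  have h4 : e / Q ^ 2 = e / y ^ 2 / ρ ^ 2 := by rw [hQy]; field_simp
  rw [h4]
  gcongr
  rw [bump, mul_div_assoc', div_le_div_iff₀ (by positivity) (by positivity)]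
  rcases le_total y 1 with h | h
  · have h5 : (1 + y) ^ 2 ≤ 4 := by nlinarith
    calc e * (1 + y) ^ 2 ≤ y ^ 4 * 4 := by gcongr
      _ = 4 * y ^ 3 * y := by ring
      _ ≤ 4 * y ^ 3 * 1 := by gcongr
      _ = _ := by ring
  · calc e * (1 + y) ^ 2 ≤ 1 * (1 + y) ^ 2 := by gcongr
      _ ≤ 4 * y ^ 2 * 1 := by nlinarith
      _ ≤ 4 * y ^ 2 * y := by gcongr
      _ = _ := by ring

/-- Size of the deviations that are not charged to the noise, for `u ^ 4` samples, when
`ρ ^ 4 = τ / K`. -/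
def slack (ρ u : ℝ) : ℝ := ρ / u ^ 3 + 1 / ρ ^ 2

theorem slack_anti {ρ u v : ℝ} (hρ : 0 < ρ) (hu : 0 < u) (huv : u ≤ v) :
    slack ρ v ≤ slack ρ u := by
  unfold slack; gcongr

theorem slack_pos {ρ u : ℝ} (hρ : 0 < ρ) (hu : 0 < u) : 0 < slack ρ u := by
  unfold slack; positivity

theorem inv_slack_pow_le_bump {Q ρ : ℝ} (hQ : 0 < Q) (hρ : 0 < ρ) :
    1 / (Q ^ 8 * slack ρ Q ^ 3) ≤ 4 * bump (Q * ρ⁻¹) / ρ ^ 2 := by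
  set y := Q * ρ⁻¹ with hy
  have hQy : Q = y * ρ := by rw [hy]; field_simp
  have hy0 : 0 < y := by positivity
  have h1 : 1 / (Q ^ 8 * slack ρ Q ^ 3) = y / (1 + y ^ 3) ^ 3 / ρ ^ 2 := by
    rw [slack, hQy]; field_simp
  rw [h1]
  gcongr
  rw [bump, mul_div_assoc', div_le_div_iff₀ (by positivity) (by positivity)]
  have h2 : (1 + y) ^ 2 ≤ 4 * (1 + y ^ 3) ^ 3 := by
    have h3 : 1 + y ^ 3 ≤ (1 + y ^ 3) ^ 3 := le_self_pow₀ (by nlinarith [pow_pos hy0 3]) (by norm_num)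
    rcases le_total y 1 with h | h
    · nlinarith [pow_pos hy0 3]
    · have : y ^ 2 ≤ y ^ 3 := pow_le_pow_right₀ h (by norm_num)
      nlinarith
  calc y * (1 + y) ^ 2 ≤ y * (4 * (1 + y ^ 3) ^ 3) := by gcongr
    _ = _ := by ring

theorem lnPlus_pow_four_le {w : ℝ} (hw : 0 < w) : lnPlus (w ^ 4) ≤ (2 * w + 1) ^ 2 := by
  unfold lnPlus
  apply max_le
  · have h1 := Real.log_le_sub_one_of_pos (show 0 < w ^ 2 by positivity)
    have h2 : Real.log (w ^ 4) = 2 * Real.log (w ^ 2) := by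
      rw [show w ^ 4 = (w ^ 2) ^ 2 by ring, Real.log_pow]; push_cast; ring
    nlinarith
  · nlinarith

theorem one_le_lnPlus (x : ℝ) : 1 ≤ lnPlus x := le_max_right _ _

theorem lnPlus_mono {x y : ℝ} (hx : 0 < x) (h : x ≤ y) : lnPlus x ≤ lnPlus y :=
  max_le_max (Real.log_le_log hx h) le_rfl

theorem exp_neg_lnPlus_le {x : ℝ} (hx : 0 < x) : Real.exp (-lnPlus x) ≤ 1 / x := by
  calc Real.exp (-lnPlus x) ≤ Real.exp (-Real.log x) :=
        Real.exp_le_exp.2 (neg_le_neg (le_max_left _ _))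
    _ = 1 / x := by rw [Real.exp_neg, Real.exp_log hx, one_div]

/-- The logarithm is traded for a power of `ρ / u`, after which the sum over sample sizes is
elementary. The leftover `1 / u ^ 2` is at most `ρ / u ^ 3` for `u ≤ ρ` and at most `1 / ρ ^ 2`
otherwise. -/
theorem radius_le_slack {K τ n : ℕ} {ρ u : ℝ} (hρ : 0 < ρ) (hu : 0 < u)
    (hρ4 : ρ ^ 4 = (τ : ℝ) / K) (hu4 : u ^ 4 = n) : radius K τ n ≤ 3 * slack ρ u := by
  have h1 : (τ : ℝ) / (K * n) = (ρ / u) ^ 4 := by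
    rw [div_pow, hρ4, hu4, div_div]
  have h2 : radius K τ n ≤ (2 * (ρ / u) + 1) / u ^ 2 := by
    unfold radius
    rw [h1, ← hu4]
    apply Real.sqrt_le_iff.2
    refine ⟨by positivity, ?_⟩
    rw [div_pow (2 * (ρ / u) + 1), ← pow_mul]
    gcongr
    exact lnPlus_pow_four_le (by positivity)
  refine h2.trans ?_
  have h3 : (2 * (ρ / u) + 1) / u ^ 2 = 2 * (ρ / u ^ 3) + 1 / u ^ 2 := by field_simp
  have h4 : 1 / u ^ 2 ≤ ρ / u ^ 3 + 1 / ρ ^ 2 := by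
    rcases le_total u ρ with h | h
    · have : 1 / u ^ 2 ≤ ρ / u ^ 3 := by
        rw [div_le_div_iff₀ (by positivity) (by positivity)]
        nlinarith [mul_le_mul_of_nonneg_right h (sq_nonneg u)]
      have : 0 < 1 / ρ ^ 2 := by positivity
      linarith
    · have : 1 / u ^ 2 ≤ 1 / ρ ^ 2 := by gcongr
      have : 0 < ρ / u ^ 3 := by positivity
      linarith
  have h5 : 0 < 1 / ρ ^ 2 := by positivity
  rw [h3, slack]
  linarith

/-! ### Levels of the sample size -/

/-- Exponent of `gridUp a m`. -/
def level (a : ℝ) (m : ℕ) : ℕ := ⌊Real.logb a m⌋₊ + 1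

theorem lt_pow_level {a : ℝ} (ha : 1 < a) {m : ℕ} (hm : 0 < m) : (m : ℝ) < a ^ level a m := by
  have hm' : (0 : ℝ) < m := Nat.cast_pos.2 hm
  have h := Nat.lt_floor_add_one (Real.logb a m)
  rw [Real.logb_lt_iff_lt_rpow ha hm'] at h
  rw [level, ← Real.rpow_natCast]
  push_cast
  exact h

theorem pow_level_le {a : ℝ} (ha : 1 < a) {m : ℕ} (hm : 0 < m) : a ^ level a m ≤ a * m := by
  have hm' : (1 : ℝ) ≤ m := Nat.one_le_cast.2 hm
  have h := Nat.floor_le (Real.logb_nonneg ha hm')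
  rw [Real.le_logb_iff_rpow_le ha (by linarith), Real.rpow_natCast] at h
  rw [level, pow_succ']
  exact mul_le_mul_of_nonneg_left h (by linarith)

theorem level_mono {a : ℝ} (ha : 1 < a) {m n : ℕ} (hm : 0 < m) (hmn : m ≤ n) :
    level a m ≤ level a n := by
  unfold level
  refine Nat.add_le_add_right ?_ 1
  exact Nat.floor_mono (Real.logb_le_logb_of_le ha (Nat.cast_pos.2 hm) (Nat.cast_le.2 hmn))

/-- The saturation limit at level `l`. -/
def levelLimit (a : ℝ) (K τ l : ℕ) : ℝ :=
  Real.sqrt (a ^ l / lnPlus ((τ : ℝ) / (K * a ^ l)))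

theorem satLimit_eq (a : ℝ) (K τ m : ℕ) : satLimit a K τ m = levelLimit a K τ (level a m) := rfl

section LevelLimit

variable {a : ℝ} {K τ : ℕ}

theorem levelLimit_pos (ha : 1 < a) (l : ℕ) : 0 < levelLimit a K τ l := by
  have h1 := one_le_lnPlus ((τ : ℝ) / (K * a ^ l))
  have : 0 < a ^ l := by positivity
  unfold levelLimit
  exact Real.sqrt_pos.2 (div_pos this (by linarith))

theorem levelLimit_sq (ha : 1 < a) (l : ℕ) :
    levelLimit a K τ l ^ 2 = a ^ l / lnPlus ((τ : ℝ) / (K * a ^ l)) := by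
  have h1 := one_le_lnPlus ((τ : ℝ) / (K * a ^ l))
  have : 0 < a ^ l := by positivity
  exact Real.sq_sqrt (div_pos this (by linarith)).le

theorem levelLimit_sq_le (ha : 1 < a) (l : ℕ) : levelLimit a K τ l ^ 2 ≤ a ^ l := by
  rw [levelLimit_sq ha]
  exact div_le_self (by positivity) (one_le_lnPlus _)

/-- The left side is the radius formula evaluated at `a ^ level a n > n`, and that formula decreases
in the sample size. One radius therefore covers the saturation bias. -/
theorem inv_levelLimit_le_radius (ha : 1 < a) (hK : 0 < K) (hτ : 0 < τ) {n : ℕ} (hn : 0 < n) :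
    1 / levelLimit a K τ (level a n) ≤ radius K τ n := by
  have hn' : (0 : ℝ) < n := Nat.cast_pos.2 hn
  have hK' : (0 : ℝ) < K := Nat.cast_pos.2 hK
  have hτ' : (0 : ℝ) < τ := Nat.cast_pos.2 hτ
  have hH := lt_pow_level ha hn
  set H := a ^ level a n
  have hH0 : 0 < H := hn'.trans hH
  have h1 := one_le_lnPlus ((τ : ℝ) / (K * H))
  have h2 : 1 / levelLimit a K τ (level a n) = Real.sqrt (lnPlus ((τ : ℝ) / (K * H)) / H) := by
    rw [levelLimit, one_div, ← Real.sqrt_inv, inv_div]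
  rw [h2]
  apply Real.sqrt_le_sqrt
  have h3 : lnPlus ((τ : ℝ) / (K * H)) ≤ lnPlus ((τ : ℝ) / (K * n)) :=
    lnPlus_mono (by positivity) (by gcongr)
  have h4 := one_le_lnPlus ((τ : ℝ) / (K * n))
  gcongr

end LevelLimit

/-! ### Constants of the exponential bound -/

/-- The parameter of the exponential moment that is used at saturation limit `B`. -/
def expParam (a ζ B : ℝ) : ℝ := Real.log (1 + 2 * ζ / a) / (2 * B)

/-- The factor in front of the exponential moment at level `l`. -/
def expCoeff (a ζ : ℝ) (K τ l : ℕ) : ℝ :=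
  a / (a ^ l * expParam a ζ (levelLimit a K τ l))
    * Real.exp (-expParam a ζ (levelLimit a K τ l) * (ζ * a ^ l / (a * levelLimit a K τ l))
      + expRate (levelLimit a K τ l) (expParam a ζ (levelLimit a K τ l)) * a ^ l)

theorem expParam_pos {a ζ B : ℝ} (ha : 1 < a) (hζ : 0 < ζ) (hB : 0 < B) : 0 < expParam a ζ B := by
  have : 0 < 2 * ζ / a := by positivity
  exact div_pos (Real.log_pos (by linarith)) (by positivity)

/-- `expParam` solves `exp (2 * B * l) = 1 + 2 * ζ / a`, which minimizes the exponent. -/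
theorem expCoeff_le {a ζ : ℝ} (ha : 1 < a) (hζ : 0 < ζ) (hψ : 2 * a / ζ ≤ psi (2 * ζ / a))
    {K τ : ℕ} (l : ℕ) :
    expCoeff a ζ K τ l ≤ 2 * a / Real.log (1 + 2 * ζ / a)
      * (Real.exp (-lnPlus ((τ : ℝ) / (K * a ^ l))) / Real.sqrt (a ^ l)) := by
  set B := levelLimit a K τ l with hBdef
  have hB : 0 < B := levelLimit_pos ha l
  set Λ := lnPlus ((τ : ℝ) / (K * a ^ l)) with hΛdef
  have hΛ : 1 ≤ Λ := one_le_lnPlus _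
  have hH : 0 < a ^ l := by positivity
  set H := a ^ l with hHdef
  have hB2 : B ^ 2 = H / Λ := levelLimit_sq ha l
  have hB2' : B ≤ Real.sqrt H := Real.le_sqrt_of_sq_le (levelLimit_sq_le ha l)
  have hs : 0 < Real.sqrt H := Real.sqrt_pos.2 hH
  set y := 2 * ζ / a with hy
  have hy0 : 0 < y := by positivity
  have hlog : 0 < Real.log (1 + y) := Real.log_pos (by linarith)
  have hpar : expParam a ζ B = Real.log (1 + y) / (2 * B) := rfl
  generalize hlg : Real.log (1 + y) = lg at hlog hpar ⊢
  have h1 : a / (H * expParam a ζ B) ≤ 2 * a / lg / Real.sqrt H := by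
    have h2 : a / (H * expParam a ζ B) = 2 * a / lg * (B / H) := by
      rw [hpar]; field_simp
    rw [h2, div_eq_mul_inv (2 * a / lg) (Real.sqrt H)]
    gcongr
    rw [div_le_iff₀ hH]
    calc B ≤ Real.sqrt H := hB2'
      _ = (Real.sqrt H)⁻¹ * (Real.sqrt H * Real.sqrt H) := by field_simp
      _ = _ := by rw [Real.mul_self_sqrt hH.le]
  -- With `y = 2 * ζ / a` the exponent equals `-(y * psi y / 4) * Λ`; the hypothesis on `psi` says
  -- exactly that `y * psi y ≥ 4`.
  have h3 : -expParam a ζ B * (ζ * H / (a * B)) + expRate B (expParam a ζ B) * H ≤ -Λ := by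
    have h4 : 2 * B * expParam a ζ B = lg := by rw [hpar]; field_simp
    have h5 : H = B ^ 2 * Λ := by rw [hB2]; field_simp
    have h6 : expRate B (expParam a ζ B) * H = (y - lg) / 4 * Λ := by
      rw [expRate, h4, ← hlg, Real.exp_log (by linarith), h5]; field_simp; ring
    have h7 : expParam a ζ B * (ζ * H / (a * B)) = lg * y / 4 * Λ := by
      rw [hpar, h5, hy]; field_simp; norm_num
    have h8 : 4 ≤ y * psi y := by
      calc (4 : ℝ) = y * (2 * a / ζ) := by rw [hy]; field_simp; norm_num
        _ ≤ y * psi y := by gcongr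
    have h9 : y * psi y = (1 + y) * lg - y := by
      rw [psi, hlg]; field_simp; ring
    rw [neg_mul, h6, h7]
    nlinarith
  calc expCoeff a ζ K τ l ≤ 2 * a / lg / Real.sqrt H * Real.exp (-Λ) := by
        unfold expCoeff
        have := expParam_pos ha hζ hB
        gcongr
    _ = _ := by ring

theorem expCoeff_nonneg {a ζ : ℝ} (ha : 1 < a) (hζ : 0 < ζ) (K τ l : ℕ) :
    0 ≤ expCoeff a ζ K τ l := by
  have := expParam_pos ha hζ (levelLimit_pos (K := K) (τ := τ) ha l)
  unfold expCoeff
  positivity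

/-- With `Q = q ^ l`, the weight of a level is of order `min 1 ((Q / ρ) ^ 4) / Q ^ 2`, which peaks
near `Q = ρ` and decays geometrically on both sides. -/
theorem sum_expCoeff_le {a ζ q ρ : ℝ} (ha : 1 < a) (hζ : 0 < ζ)
    (hψ : 2 * a / ζ ≤ psi (2 * ζ / a)) (hq : 1 < q) (hqa : q ^ 4 = a) {K τ : ℕ} (hK : 0 < K)
    (hτ : 0 < τ) (hρ : 0 < ρ) (hρ4 : ρ ^ 4 = (τ : ℝ) / K) (n : ℕ) :
    ∑ l ∈ Finset.range n, expCoeff a ζ K τ l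
      ≤ 2 * a / Real.log (1 + 2 * ζ / a) * (4 * (q / (q - 1))) / ρ ^ 2 := by
  have hlog : 0 < Real.log (1 + 2 * ζ / a) := by
    have : 0 < 2 * ζ / a := by positivity
    exact Real.log_pos (by linarith)
  have hq0 : 0 < q := by linarith
  have hK' : (0 : ℝ) < K := Nat.cast_pos.2 hK
  have hτ' : (0 : ℝ) < τ := Nat.cast_pos.2 hτ
  have h1 : ∀ l, expCoeff a ζ K τ l
      ≤ 2 * a / Real.log (1 + 2 * ζ / a) * (4 * bump (q ^ l * ρ⁻¹) / ρ ^ 2) := by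
    intro l
    refine (expCoeff_le ha hζ hψ l).trans ?_
    have hH : a ^ l = (q ^ l) ^ 4 := by rw [← hqa, ← pow_mul, ← pow_mul, mul_comm]
    have hsq : Real.sqrt (a ^ l) = (q ^ l) ^ 2 := by
      rw [hH, show (q ^ l) ^ 4 = ((q ^ l) ^ 2) ^ 2 by ring, Real.sqrt_sq (by positivity)]
    rw [hsq]
    refine mul_le_mul_of_nonneg_left ?_ (by positivity)
    apply inv_sq_mul_le_bump (by positivity) hρ
    · rw [Real.exp_le_one_iff]; linarith [one_le_lnPlus ((τ : ℝ) / (K * a ^ l))]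
    · refine (exp_neg_lnPlus_le (by positivity)).trans (le_of_eq ?_)
      rw [hρ4, ← hH]; field_simp
  calc _ ≤ ∑ l ∈ Finset.range n, 2 * a / Real.log (1 + 2 * ζ / a)
        * (4 * bump (q ^ l * ρ⁻¹) / ρ ^ 2) := Finset.sum_le_sum fun l _ => h1 l
    _ = 2 * a / Real.log (1 + 2 * ζ / a) * (4 * ∑ l ∈ Finset.range n, bump (q ^ l * ρ⁻¹))
        / ρ ^ 2 := by
        rw [Finset.mul_sum, Finset.mul_sum, Finset.sum_div]
        exact Finset.sum_congr rfl fun l _ => by ring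
    _ ≤ _ := by
        gcongr
        exact sum_bump_le hq (by positivity) n

end

section

variable {K T : ℕ} {π : Policy K} {ν : Environment K T} {B : ℝ} {k : Fin K}

/-! ### Counting selections -/

/-- The fourth root of a natural number. -/
def fourthRoot (n : ℕ) : ℝ := (n : ℝ) ^ (1 / 4 : ℝ)

theorem fourthRoot_nonneg (n : ℕ) : 0 ≤ fourthRoot n := by unfold fourthRoot; positivity

theorem fourthRoot_pos {n : ℕ} (hn : 0 < n) : 0 < fourthRoot n := by
  have : (0 : ℝ) < n := Nat.cast_pos.2 hn
  unfold fourthRoot; positivity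

theorem fourthRoot_pow (n : ℕ) : fourthRoot n ^ 4 = n := by
  rw [fourthRoot, ← Real.rpow_natCast, ← Real.rpow_mul (by positivity)]
  norm_num

theorem fourthRoot_mono {m n : ℕ} (h : m ≤ n) : fourthRoot m ≤ fourthRoot n := by
  unfold fourthRoot
  gcongr

theorem fourthRoot_succ_le {n : ℕ} (hn : 0 < n) : fourthRoot (n + 1) ≤ 2 * fourthRoot n := by
  have h0 := fourthRoot_pos hn
  refine le_of_pow_le_pow_left₀ (n := 4) (by norm_num) (by positivity) ?_
  have h1 : (1 : ℝ) ≤ n := Nat.one_le_cast.2 hn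
  rw [mul_pow, fourthRoot_pow, fourthRoot_pow]
  push_cast
  linarith

/-- A difference of fourth powers equal to `1`, factored: the cofactor of `u - v` is at most `4 * u
^ 3`. -/
theorem inv_fourthRoot_pow_le (p : ℕ) :
    1 / fourthRoot (p + 1) ^ 3 ≤ 4 * (fourthRoot (p + 1) - fourthRoot p) := by
  have hu := fourthRoot_pos (Nat.succ_pos p)
  have hv := fourthRoot_nonneg p
  have huv := fourthRoot_mono (Nat.le_succ p)
  have hu4 := fourthRoot_pow (p + 1)
  have hv4 := fourthRoot_pow p
  push_cast at hu4
  simp only [Nat.succ_eq_add_one] at hu huv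
  set u := fourthRoot (p + 1)
  set v := fourthRoot p
  rw [div_le_iff₀ (by positivity)]
  have h1 : u ^ 2 * v + u * v ^ 2 + v ^ 3 ≤ 3 * u ^ 3 := by
    have h2 : u ^ 2 * v ≤ u ^ 2 * u := by gcongr
    have h3 : u * v ^ 2 ≤ u * u ^ 2 := by gcongr
    have h4 : v ^ 3 ≤ u ^ 3 := by gcongr
    nlinarith
  nlinarith [mul_le_mul_of_nonneg_left h1 (sub_nonneg.2 huv)]

/-- Within an epoch of at most `τ` slots every window reaches back to the start of the epoch, so the
window count dominates the epoch count and the sum telescopes. -/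
theorem sum_inv_fourthRoot_epoch_le {τ t₀ j : ℕ} (hj : j ≤ τ) (x : Fin T → Fin K → ℝ) :
    ∑ t ∈ Finset.Ico t₀ (t₀ + j),
      (pulled π k t x : ℝ) * (1 / fourthRoot (pullCount π k (t - τ) t x + 1) ^ 3)
      ≤ 4 * fourthRoot (pullCount π k t₀ (t₀ + j) x) := by
  induction j with
  | zero => simp [pullCount, fourthRoot]
  | succ j ih =>
    rw [← add_assoc, Finset.sum_Ico_succ_top (by omega), pullCount_succ (by omega)]
    have h1 := ih (by omega)
    have h2 := pulled_le_one (π := π) (k := k) (t₀ + j) x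
    rcases Nat.le_one_iff_eq_zero_or_eq_one.1 h2 with h | h
    · simpa [h] using h1
    · rw [h]
      have h3 : pullCount π k t₀ (t₀ + j) x ≤ pullCount π k (t₀ + j - τ) (t₀ + j) x :=
        pullCount_mono (by omega) le_rfl x
      have h4 := inv_fourthRoot_pow_le (pullCount π k t₀ (t₀ + j) x)
      have h5 : 1 / fourthRoot (pullCount π k (t₀ + j - τ) (t₀ + j) x + 1) ^ 3
          ≤ 1 / fourthRoot (pullCount π k t₀ (t₀ + j) x + 1) ^ 3 := by
        have h6 := fourthRoot_pos (Nat.succ_pos (pullCount π k t₀ (t₀ + j) x))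
        have h7 := fourthRoot_mono (Nat.add_le_add_right h3 1)
        simp only [Nat.succ_eq_add_one] at h6
        gcongr
      push_cast
      linarith

theorem sum_pullCount_le_sub (s t : ℕ) (x : Fin T → Fin K → ℝ) :
    ∑ k, pullCount π k s t x ≤ t - s := by
  unfold pullCount
  rw [Finset.sum_comm]
  refine (Finset.sum_le_sum (g := fun _ => 1) fun r _ => ?_).trans (by simp)
  by_cases h : r < T
  · exact (sum_pulled_eq_one h x).le
  · simp [pulled, h]

/-- Each epoch of `τ` slots costs `8 * τ / ρ ^ 2`. As `τ ≤ T`, covering the horizon takes at most `2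
* T / τ` epochs; the constant part of `slack` adds one more `T / ρ ^ 2`. -/
theorem sum_slack_le {τ : ℕ} {ρ : ℝ} (hK : 0 < K) (hτ : 0 < τ) (hτT : τ ≤ T) (hρ : 0 < ρ)
    (hρ4 : ρ ^ 4 = (τ : ℝ) / K) (x : Fin T → Fin K → ℝ) :
    ∑ t ∈ Finset.range T, ∑ k, (pulled π k t x : ℝ)
      * slack ρ (fourthRoot (pullCount π k (t - τ) t x + 1)) ≤ 17 * (T / ρ ^ 2) := by
  have hτ' : (0 : ℝ) < τ := Nat.cast_pos.2 hτ
  have hK' : (0 : ℝ) < K := Nat.cast_pos.2 hK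
  set f : ℕ → Fin K → ℝ := fun t k => (pulled π k t x : ℝ)
    * (1 / fourthRoot (pullCount π k (t - τ) t x + 1) ^ 3) with hf
  have hf0 : ∀ t k, 0 ≤ f t k := fun t k => by
    have := fourthRoot_pos (Nat.succ_pos (pullCount π k (t - τ) t x))
    simp only [Nat.succ_eq_add_one] at this
    simp only [hf]
    positivity
  have hyoung : ∀ n : ℕ, ρ * fourthRoot n ≤ ρ ^ 2 + n / ρ ^ 2 := by
    intro n
    have hv := fourthRoot_nonneg n
    have hv4 := fourthRoot_pow n
    rw [← hv4]
    set v := fourthRoot n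
    rcases le_total v ρ with h | h
    · have : 0 ≤ v ^ 4 / ρ ^ 2 := by positivity
      nlinarith
    · have h1 : ρ * v ≤ v ^ 4 / ρ ^ 2 := by
        rw [le_div_iff₀ (by positivity)]
        calc ρ * v * ρ ^ 2 = ρ ^ 3 * v := by ring
          _ ≤ v ^ 3 * v := by gcongr
          _ = v ^ 4 := by ring
      nlinarith
  have hepoch : ∀ t₀, ∑ t ∈ Finset.Ico t₀ (t₀ + τ), ρ * ∑ k, f t k ≤ 8 * (τ / ρ ^ 2) := by
    intro t₀
    rw [← Finset.mul_sum, Finset.sum_comm]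
    calc ρ * ∑ k, ∑ t ∈ Finset.Ico t₀ (t₀ + τ), f t k
        ≤ ρ * ∑ k, 4 * fourthRoot (pullCount π k t₀ (t₀ + τ) x) := by
          gcongr with k _
          exact sum_inv_fourthRoot_epoch_le le_rfl x
      _ = ∑ k, 4 * (ρ * fourthRoot (pullCount π k t₀ (t₀ + τ) x)) := by
          rw [Finset.mul_sum]; exact Finset.sum_congr rfl fun k _ => by ring
      _ ≤ ∑ k, 4 * (ρ ^ 2 + pullCount π k t₀ (t₀ + τ) x / ρ ^ 2) := by
          gcongr with k _
          exact hyoung _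
      _ = 4 * (K * ρ ^ 2 + (∑ k, (pullCount π k t₀ (t₀ + τ) x : ℝ)) / ρ ^ 2) := by
          rw [← Finset.mul_sum, Finset.sum_add_distrib, Finset.sum_div]; simp
      _ ≤ 4 * (K * ρ ^ 2 + τ / ρ ^ 2) := by
          gcongr
          have := sum_pullCount_le_sub (π := π) t₀ (t₀ + τ) x
          rw [Nat.add_sub_cancel_left] at this
          exact_mod_cast this
      _ = 8 * (τ / ρ ^ 2) := by
          -- The choice of `ρ` makes the per-arm cost `K * ρ ^ 2` equal to the per-slot cost `τ / ρ
          -- ^ 2`.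
          have : (τ : ℝ) = K * ρ ^ 4 := by rw [hρ4]; field_simp
          rw [this]; field_simp; ring
  have hall : ∀ e : ℕ, ∑ t ∈ Finset.range (e * τ), ρ * ∑ k, f t k ≤ e * (8 * (τ / ρ ^ 2)) := by
    intro e
    induction e with
    | zero => simp
    | succ e ih =>
      rw [Nat.add_mul, one_mul, ← Finset.sum_range_add_sum_Ico _ (Nat.le_add_right (e * τ) τ)]
      push_cast
      linarith [hepoch (e * τ)]
  have hT : ∑ t ∈ Finset.range T, ρ * ∑ k, f t k ≤ 16 * (T / ρ ^ 2) := by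
    have h1 : T ≤ (T / τ + 1) * τ := ((Nat.div_lt_iff_lt_mul hτ).1 (Nat.lt_succ_self _)).le
    have h2 : (((T / τ + 1 : ℕ) : ℝ)) * τ ≤ 2 * T := by
      have h3 : (T / τ + 1) * τ ≤ 2 * T := by
        have := Nat.div_mul_le_self T τ
        rw [Nat.add_mul]; omega
      exact_mod_cast h3
    calc _ ≤ ∑ t ∈ Finset.range ((T / τ + 1) * τ), ρ * ∑ k, f t k :=
          Finset.sum_le_sum_of_subset_of_nonneg (Finset.range_mono h1) fun t _ _ =>
            mul_nonneg hρ.le (Finset.sum_nonneg fun k _ => hf0 t k)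
      _ ≤ ((T / τ + 1 : ℕ) : ℝ) * (8 * (τ / ρ ^ 2)) := hall _
      _ = 8 * ((((T / τ + 1 : ℕ) : ℝ)) * τ / ρ ^ 2) := by ring
      _ ≤ 8 * (2 * T / ρ ^ 2) := by gcongr
      _ = _ := by ring
  have hrest : ∑ t ∈ Finset.range T, ∑ k, (pulled π k t x : ℝ) * (1 / ρ ^ 2) = T / ρ ^ 2 := by
    have : ∀ t ∈ Finset.range T, ∑ k, (pulled π k t x : ℝ) * (1 / ρ ^ 2) = 1 / ρ ^ 2 := by
      intro t ht
      rw [← Finset.sum_mul]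
      have h := sum_pulled_eq_one (π := π) (Finset.mem_range.1 ht) x
      have h' : ∑ k, (pulled π k t x : ℝ) = 1 := by exact_mod_cast h
      rw [h', one_mul]
    rw [Finset.sum_congr rfl this]
    simp
    ring
  have hsplit : ∑ t ∈ Finset.range T, ∑ k, (pulled π k t x : ℝ)
      * slack ρ (fourthRoot (pullCount π k (t - τ) t x + 1))
      = ∑ t ∈ Finset.range T, ρ * ∑ k, f t k
        + ∑ t ∈ Finset.range T, ∑ k, (pulled π k t x : ℝ) * (1 / ρ ^ 2) := by
    rw [← Finset.sum_add_distrib]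
    refine Finset.sum_congr rfl fun t _ => ?_
    rw [Finset.mul_sum, ← Finset.sum_add_distrib]
    refine Finset.sum_congr rfl fun k _ => ?_
    simp only [hf, slack]
    ring
  rw [hsplit, hrest]
  have : (0 : ℝ) ≤ T / ρ ^ 2 := by positivity
  linarith

/-! ### Variation of the means -/

/-- The largest change of a mean reward from slot `r` to slot `r + 1`. -/
def drift (ν : Environment K T) (r : ℕ) : ℝ :=
  if h : r + 1 < T then
    ⨆ k : Fin K, |ν.mean ⟨r + 1, h⟩ k - ν.mean ⟨r, Nat.lt_of_succ_lt h⟩ k| else 0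

theorem drift_nonneg (ν : Environment K T) (r : ℕ) : 0 ≤ drift ν r := by
  unfold drift
  split_ifs
  · exact Real.iSup_nonneg fun k => abs_nonneg _
  · exact le_rfl

theorem sum_drift (ν : Environment K T) : ∑ r ∈ Finset.range T, drift ν r = ν.variation := by
  rw [← Fin.sum_univ_eq_sum_range]
  rfl

theorem abs_mean_sub_le {s t : ℕ} (hst : s ≤ t) (ht : t < T) :
    |ν.mean ⟨t, ht⟩ k - ν.mean ⟨s, hst.trans_lt ht⟩ k| ≤ ∑ r ∈ Finset.Ico s t, drift ν r := by
  induction t, hst using Nat.le_induction with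
  | base => simp
  | succ t hst ih =>
    rw [Finset.sum_Ico_succ_top hst]
    have h1 := ih (by omega)
    have h2 : |ν.mean ⟨t + 1, ht⟩ k - ν.mean ⟨t, by omega⟩ k| ≤ drift ν t := by
      rw [drift, dif_pos ht]
      exact le_ciSup (f := fun k => |ν.mean ⟨t + 1, ht⟩ k - ν.mean ⟨t, by omega⟩ k|)
        (Set.finite_range _).bddAbove k
    have h3 := abs_sub_le (ν.mean ⟨t + 1, ht⟩ k) (ν.mean ⟨t, by omega⟩ k)
      (ν.mean ⟨s, by omega⟩ k)
    linarith

/-- The change of the means within the window before slot `t`. -/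
def windowDrift (ν : Environment K T) (τ t : ℕ) : ℝ := ∑ r ∈ Finset.Ico (t - τ) t, drift ν r

theorem windowDrift_nonneg (ν : Environment K T) (τ t : ℕ) : 0 ≤ windowDrift ν τ t :=
  Finset.sum_nonneg fun r _ => drift_nonneg ν r

/-- The change from slot `r` to `r + 1` enters only the windows of slots `r + 1, …, r + τ`. -/
theorem sum_windowDrift_le (ν : Environment K T) (τ : ℕ) :
    ∑ t ∈ Finset.range T, windowDrift ν τ t ≤ τ * ν.variation := by
  have h1 : ∀ t ∈ Finset.range T, windowDrift ν τ t
      = ∑ r ∈ Finset.range T, if t ∈ Finset.Ioc r (r + τ) then drift ν r else 0 := by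
    intro t ht
    rw [Finset.mem_range] at ht
    rw [windowDrift, ← Finset.sum_filter]
    refine Finset.sum_congr ?_ fun _ _ => rfl
    ext r
    simp only [Finset.mem_Ico, Finset.mem_filter, Finset.mem_range, Finset.mem_Ioc]
    omega
  rw [Finset.sum_congr rfl h1, Finset.sum_comm, ← sum_drift, Finset.mul_sum]
  refine Finset.sum_le_sum fun r _ => ?_
  rw [← Finset.sum_filter, Finset.sum_const, nsmul_eq_mul]
  refine mul_le_mul_of_nonneg_right ?_ (drift_nonneg ν r)
  have : (Finset.filter (fun t => t ∈ Finset.Ioc r (r + τ)) (Finset.range T)).card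
      ≤ (Finset.Ioc r (r + τ)).card :=
    Finset.card_le_card fun t ht => (Finset.mem_filter.1 ht).2
  simp only [Nat.card_Ioc, Nat.add_sub_cancel_left] at this
  exact_mod_cast this

/-! ### The index along a run -/

theorem sum_windowSlots {M : Type*} [AddCommMonoid M] {t : ℕ} (τ : ℕ) (H : Fin t → Fin K × ℝ)
    (F : Fin t → M) (G : ℕ → M) (h : ∀ s : Fin t, (if (H s).1 = k then F s else 0) = G s) :
    ∑ s ∈ windowSlots τ H k, F s = ∑ s ∈ Finset.Ico (t - τ) t, G s := by
  have h1 : ∑ s ∈ windowSlots τ H k, F s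
      = ∑ s : Fin t, if t ≤ (s : ℕ) + τ then G s else 0 := by
    rw [windowSlots, Finset.sum_filter]
    refine Finset.sum_congr rfl fun s _ => ?_
    rw [← h s]
    by_cases h1 : t ≤ (s : ℕ) + τ <;> simp [h1]
  rw [h1, Fin.sum_univ_eq_sum_range (fun s => if t ≤ s + τ then G s else 0), ← Finset.sum_filter]
  refine Finset.sum_congr ?_ fun _ _ => rfl
  ext s
  simp only [Finset.mem_Ico, Finset.mem_filter, Finset.mem_range]
  omega

theorem card_windowSlots_history (τ t : ℕ) (ht : t ≤ T) (x : Fin T → Fin K → ℝ) :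
    (windowSlots τ (π.history x t ht) k).card = pullCount π k (t - τ) t x := by
  rw [Finset.card_eq_sum_ones]
  refine sum_windowSlots τ _ _ _ fun s => ?_
  simp [pulled, π.history_apply, s.isLt.trans_le ht]

/-- The saturated mean is, up to the noise, close to the current mean reward. -/
theorem abs_satMean_sub_le (hν : ν.HeavyTailed) {a : ℝ} (ha : 1 < a) {τ t : ℕ} (ht : t < T)
    (x : Fin T → Fin K → ℝ) {n : ℕ} (hn : pullCount π k (t - τ) t x = n) (hn0 : 0 < n) :
    |satMean a τ (π.history x t ht.le) k
      - noiseSum π ν (levelLimit a K τ (level a n)) k (t - τ) t x / n - ν.mean ⟨t, ht⟩ k|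
      ≤ windowDrift ν τ t + 1 / levelLimit a K τ (level a n) := by
  set B := levelLimit a K τ (level a n) with hBdef
  have hB : 0 < B := levelLimit_pos ha _
  have hn' : (0 : ℝ) < n := Nat.cast_pos.2 hn0
  set G : ℕ → ℝ := fun s => if h : s < T then
    (if π.arm x ⟨s, h⟩ = k then sat (x ⟨s, h⟩ k) B else 0) else 0 with hG
  have h1 : satMean a τ (π.history x t ht.le) k = (∑ s ∈ Finset.Ico (t - τ) t, G s) / n := by
    unfold satMean
    rw [card_windowSlots_history, hn, satLimit_eq, ← hBdef,
      sum_windowSlots τ _ _ G fun s => ?_]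
    · ring
    · simp only [hG, π.history_apply, s.isLt.trans ht, dite_true]
      split_ifs with h <;> simp [h]
  have h2 : satMean a τ (π.history x t ht.le) k - noiseSum π ν B k (t - τ) t x / n
      - ν.mean ⟨t, ht⟩ k = (∑ s ∈ Finset.Ico (t - τ) t,
        (G s - noise π ν B k s x - pulled π k s x * ν.mean ⟨t, ht⟩ k)) / n := by
    rw [h1, Finset.sum_sub_distrib, Finset.sum_sub_distrib, ← Finset.sum_mul, ← Nat.cast_sum,
      ← pullCount, ← noiseSum, hn]
    field_simp
  rw [h2, abs_div, abs_of_pos hn', div_le_iff₀ hn']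
  calc _ ≤ ∑ s ∈ Finset.Ico (t - τ) t,
        |G s - noise π ν B k s x - pulled π k s x * ν.mean ⟨t, ht⟩ k| :=
        Finset.abs_sum_le_sum_abs _ _
    _ ≤ ∑ s ∈ Finset.Ico (t - τ) t, (windowDrift ν τ t + 1 / B) * pulled π k s x := by
        refine Finset.sum_le_sum fun s hs => ?_
        rw [Finset.mem_Ico] at hs
        have hsT : s < T := hs.2.trans ht
        simp only [hG, noise, pulled, hsT, dite_true]
        split_ifs with h
        · have h3 := abs_integral_sat_sub_le (μ := (ν ⟨s, hsT⟩ k : Measure ℝ)) hB (hν _ _)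
          have h4 := abs_mean_sub_le (ν := ν) (k := k) hs.2.le ht
          have h5 : ∑ r ∈ Finset.Ico s t, drift ν r ≤ windowDrift ν τ t :=
            Finset.sum_le_sum_of_subset_of_nonneg (Finset.Ico_subset_Ico hs.1 le_rfl)
              fun r _ _ => drift_nonneg ν r
          change |_ - ν.mean ⟨s, hsT⟩ k| ≤ _ at h3
          rw [abs_le] at h3 h4 ⊢
          push_cast
          constructor <;> linarith [h3.1, h3.2, h4.1, h4.2]
        · simp
    _ = _ := by rw [← Finset.mul_sum, ← Nat.cast_sum, ← pullCount, hn]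

end

section

variable {K T : ℕ} {π : Policy K} {ν : Environment K T} {k : Fin K}

/-! ### Regret as expected loss of mean reward -/

theorem Environment.HeavyTailed.abs_mean_le_one (hν : ν.HeavyTailed) (t : Fin T) (k : Fin K) :
    |ν.mean t k| ≤ 1 :=
  abs_integral_id_le_one (hν t k)

theorem Environment.mean_le_bestMean (ν : Environment K T) (t : Fin T) (k : Fin K) :
    ν.mean t k ≤ ν.bestMean t :=
  le_ciSup (f := fun k => ν.mean t k) (Set.finite_range _).bddAbove k

theorem Environment.exists_mean_eq_bestMean (ν : Environment K T) (hK : 0 < K) (t : Fin T) :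
    ∃ k, ν.mean t k = ν.bestMean t := by
  have : Nonempty (Fin K) := ⟨⟨0, hK⟩⟩
  exact exists_eq_ciSup_of_finite

theorem integrable_reward (hν : ν.HeavyTailed) (t : Fin T) (k : Fin K) :
    Integrable (fun x : Fin T → Fin K → ℝ => x t k) ν.rewardLaw := by
  have h1 := measurePreserving_eval (fun k => (ν t k : Measure ℝ)) k
  have h2 := measurePreserving_eval (fun t => Measure.pi fun k => (ν t k : Measure ℝ)) t
  exact (h1.comp h2).integrable_comp_of_integrable (integrable_id_of_lintegral_le (hν t k))

/-- Resampling row `t` leaves the selection at `t` unchanged, so the reward may be averaged with the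
arm frozen. -/
theorem integral_reward_arm (hπ : ∀ t, Measurable (π t)) (hν : ν.HeavyTailed) (t : Fin T) :
    Integrable (fun x => x t (π.arm x t)) ν.rewardLaw ∧
      ∫ x, x t (π.arm x t) ∂ν.rewardLaw = ∫ x, ν.mean t (π.arm x t) ∂ν.rewardLaw := by
  have hm : Measurable fun x : Fin T → Fin K → ℝ => x t (π.arm x t) := by
    have : Measurable (fun p : (Fin K → ℝ) × Fin K => p.1 p.2) :=
      measurable_from_prod_countable_left fun k => measurable_pi_apply k
    exact this.comp ((measurable_pi_apply _).prodMk (Policy.measurable_arm hπ t))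
  have hi : Integrable (fun x => x t (π.arm x t)) ν.rewardLaw := by
    refine (integrable_finsetSum Finset.univ fun k _ => (integrable_reward hν t k).abs).mono'
      hm.aestronglyMeasurable ?_
    filter_upwards with x
    exact Finset.single_le_sum (f := fun k => |x t k|) (fun k _ => abs_nonneg _)
      (Finset.mem_univ (π.arm x t))
  refine ⟨hi, ?_⟩
  rw [integral_rewardLaw_update ν t hm hi]
  refine integral_congr_ae ?_
  filter_upwards with x
  simp only [π.arm_update x t _ t le_rfl, Function.update_self]
  have h := measurePreserving_eval (fun k => (ν t k : Measure ℝ)) (π.arm x t)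
  rw [Environment.mean, ← h.map_eq, integral_map h.measurable.aemeasurable (by fun_prop)]

theorem integrable_mean_arm (hπ : ∀ t, Measurable (π t)) (hν : ν.HeavyTailed) (t : Fin T) :
    Integrable (fun x => ν.mean t (π.arm x t)) ν.rewardLaw := by
  refine Integrable.of_bound (Measurable.aestronglyMeasurable ?_) 1 ?_
  · exact (measurable_from_top (f := fun k => ν.mean t k)).comp (Policy.measurable_arm hπ t)
  · filter_upwards with x using hν.abs_mean_le_one t _

theorem regret_eq (hπ : ∀ t, Measurable (π t)) (hν : ν.HeavyTailed) :
    π.regret ν = ∫ x, ∑ t : Fin T, (ν.bestMean t - ν.mean t (π.arm x t)) ∂ν.rewardLaw := by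
  have h1 : ∀ t : Fin T, Integrable (fun x => ν.bestMean t - ν.mean t (π.arm x t)) ν.rewardLaw :=
    fun t => (integrable_const _).sub (integrable_mean_arm hπ hν t)
  rw [Policy.regret, integral_finsetSum _ fun t _ => (integral_reward_arm hπ hν t).1,
    integral_finsetSum _ fun t _ => h1 t, ← Finset.sum_sub_distrib]
  refine Finset.sum_congr rfl fun t _ => ?_
  rw [integral_sub (integrable_const _) (integrable_mean_arm hπ hν t),
    (integral_reward_arm hπ hν t).2]
  simp

theorem bestMean_sub_le_two (hν : ν.HeavyTailed) (hK : 0 < K) (t : Fin T) (k : Fin K) :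
    ν.bestMean t - ν.mean t k ≤ 2 := by
  obtain ⟨j, hj⟩ := ν.exists_mean_eq_bestMean hK t
  rw [← hj]
  linarith [(abs_le.1 (hν.abs_mean_le_one t j)).2, (abs_le.1 (hν.abs_mean_le_one t k)).1]

theorem regret_le_two_mul (hπ : ∀ t, Measurable (π t)) (hν : ν.HeavyTailed) (hK : 0 < K) :
    π.regret ν ≤ 2 * T := by
  rw [regret_eq hπ hν]
  calc _ ≤ ∫ _x : Fin T → Fin K → ℝ, (2 * T : ℝ) ∂ν.rewardLaw := by
        refine integral_mono (integrable_finsetSum _ fun t _ =>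
          (integrable_const _).sub (integrable_mean_arm hπ hν t)) (integrable_const _) fun x => ?_
        calc _ ≤ ∑ _t : Fin T, (2 : ℝ) :=
              Finset.sum_le_sum fun t _ => bestMean_sub_le_two hν hK t _
          _ = _ := by simp; ring
    _ = _ := by simp

/-! ### The loss of a single slot -/

/-- The term that bounds how far the index of arm `k` lies below its mean reward at slot `t`. -/
def lowerTerm (a ζ : ℝ) (τ : ℕ) (π : Policy K) (ν : Environment K T) (k : Fin K) (t l : ℕ)
    (x : Fin T → Fin K → ℝ) : ℝ :=
  Real.exp (-expParam a ζ (levelLimit a K τ l)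
      * noiseSum π ν (levelLimit a K τ l) k (t - τ) t x
    - expRate (levelLimit a K τ l) (expParam a ζ (levelLimit a K τ l))
      * pullCount π k (t - τ) t x)

/-- The fourth power of the noise of arm `k` in the window, if the window has few samples. -/
def upperTerm (a : ℝ) (τ : ℕ) (π : Policy K) (ν : Environment K T) (k : Fin K) (t l : ℕ)
    (x : Fin T → Fin K → ℝ) : ℝ :=
  if pullCount π k (t - τ) t x ≤ ⌈a ^ l⌉₊ then
    noiseSum π ν (levelLimit a K τ l) k (t - τ) t x ^ 4 else 0

/-- The factor of `upperTerm`. -/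
def upperCoeff (a ρ q : ℝ) (l : ℕ) : ℝ := a ^ 4 / ((a ^ l) ^ 4 * slack ρ (q ^ l) ^ 3)

/-- Of the `1 + ζ` radii in the index, one absorbs the saturation bias and the other `ζ` are left
against the noise, whose remaining positive part is bounded by an exponential. -/
theorem mean_sub_index_le (hν : ν.HeavyTailed) {a ζ : ℝ} (ha : 1 < a) (hζ : 0 < ζ) (hK : 0 < K)
    {τ : ℕ} (hτ : 0 < τ) {t : ℕ} (ht : t < T) (x : Fin T → Fin K → ℝ)
    (hn0 : 0 < pullCount π k (t - τ) t x) :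
    ν.mean ⟨t, ht⟩ k - (satMean a τ (π.history x t ht.le) k
        + (1 + ζ) * radius K τ (pullCount π k (t - τ) t x))
      ≤ windowDrift ν τ t
        + ∑ l ∈ Finset.range (level a T + 1), expCoeff a ζ K τ l * lowerTerm a ζ τ π ν k t l x := by
  obtain ⟨n, hn⟩ : ∃ n, pullCount π k (t - τ) t x = n := ⟨_, rfl⟩
  rw [hn] at hn0 ⊢
  have hmain := (abs_le.1 (abs_satMean_sub_le hν ha ht x hn hn0)).1
  have hrad := inv_levelLimit_le_radius (K := K) (τ := τ) ha hK hτ hn0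
  have hnT : n ≤ T := by
    have := pullCount_le_sub (π := π) (k := k) (t - τ) t x
    omega
  have hlev := level_mono ha hn0 hnT
  have hsingle : expCoeff a ζ K τ (level a n) * lowerTerm a ζ τ π ν k t (level a n) x
      ≤ ∑ l ∈ Finset.range (level a T + 1), expCoeff a ζ K τ l * lowerTerm a ζ τ π ν k t l x :=
    Finset.single_le_sum (f := fun l => expCoeff a ζ K τ l * lowerTerm a ζ τ π ν k t l x)
      (fun l _ => mul_nonneg (expCoeff_nonneg ha hζ K τ l) (Real.exp_pos _).le)
      (Finset.mem_range.2 (by omega))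
  have hHn := lt_pow_level ha hn0
  have hHa := pow_level_le ha hn0
  have hn' : (0 : ℝ) < n := Nat.cast_pos.2 hn0
  have hkey : -(noiseSum π ν (levelLimit a K τ (level a n)) k (t - τ) t x / n)
      - ζ / levelLimit a K τ (level a n)
      ≤ expCoeff a ζ K τ (level a n) * lowerTerm a ζ τ π ν k t (level a n) x := by
    unfold expCoeff lowerTerm
    rw [hn]
    have hB : 0 < levelLimit a K τ (level a n) := levelLimit_pos ha _
    set B := levelLimit a K τ (level a n)
    set S := noiseSum π ν B k (t - τ) t x
    set H := a ^ level a n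
    have hH0 : 0 < H := hn'.trans hHn
    have hlam : 0 < expParam a ζ B := expParam_pos ha hζ hB
    set lam := expParam a ζ B
    have hg : 0 ≤ expRate B lam := expRate_nonneg B lam
    set g := expRate B lam
    -- The random `n` is replaced by its level through `n < H ≤ a * n`, so that the bound depends on
    -- the sample only through `S` and the level.
    have h1 : -(S / n) - ζ / B ≤ a / H * max (-S - ζ * H / (a * B)) 0 := by
      have h2 : -(S / n) - ζ / B = 1 / n * (-S - n * ζ / B) := by field_simp
      have h3 : ζ * H / (a * B) ≤ n * ζ / B := by
        rw [div_le_div_iff₀ (by positivity) hB]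
        nlinarith [mul_le_mul_of_nonneg_left hHa (mul_pos hζ hB).le]
      have h4 : 1 / (n : ℝ) ≤ a / H := by
        rw [div_le_div_iff₀ hn' hH0]; linarith
      rw [h2]
      calc 1 / (n : ℝ) * (-S - n * ζ / B) ≤ 1 / n * max (-S - ζ * H / (a * B)) 0 := by
            gcongr
            exact le_max_of_le_left (by linarith)
        _ ≤ _ := by gcongr
    have h5 : max (-S - ζ * H / (a * B)) 0 ≤ 1 / lam * Real.exp (lam * (-S - ζ * H / (a * B))) := by
      rw [one_div_mul_eq_div, le_div_iff₀ hlam]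
      rcases max_cases (-S - ζ * H / (a * B)) 0 with ⟨h, _⟩ | ⟨h, _⟩ <;> rw [h]
      · linarith [Real.add_one_le_exp (lam * (-S - ζ * H / (a * B)))]
      · rw [zero_mul]; exact (Real.exp_pos _).le
    calc _ ≤ a / H * max (-S - ζ * H / (a * B)) 0 := h1
      _ ≤ a / H * (1 / lam * Real.exp (lam * (-S - ζ * H / (a * B)))) := by gcongr
      _ = a / (H * lam) * Real.exp (lam * (-S - ζ * H / (a * B))) := by field_simp
      _ ≤ a / (H * lam) * Real.exp ((-lam * (ζ * H / (a * B)) + g * H) + (-lam * S - g * n)) := by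
          gcongr
          nlinarith [mul_le_mul_of_nonneg_left hHn.le hg]
      _ = _ := by rw [Real.exp_add]; ring
  have h6 : (1 + ζ) * (1 / levelLimit a K τ (level a n)) ≤ (1 + ζ) * radius K τ n :=
    mul_le_mul_of_nonneg_left hrad (by linarith)
  have h7 : (1 + ζ) * (1 / levelLimit a K τ (level a n))
      = 1 / levelLimit a K τ (level a n) + ζ / levelLimit a K τ (level a n) := by ring
  linarith

/-- A pointwise fourth-moment Markov inequality, with threshold `θ`. -/
theorem le_add_pow_div {v θ : ℝ} (hv : 0 ≤ v) (hθ : 0 < θ) : v ≤ θ + v ^ 4 / θ ^ 3 := by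
  rcases le_total v θ with h | h
  · have : 0 ≤ v ^ 4 / θ ^ 3 := by positivity
    linarith
  · have : v ≤ v ^ 4 / θ ^ 3 := by
      rw [le_div_iff₀ (by positivity)]
      calc v * θ ^ 3 ≤ v * v ^ 3 := by gcongr
        _ = v ^ 4 := by ring
    linarith

theorem upperTerm_nonneg (a : ℝ) (τ : ℕ) (t l : ℕ) (x : Fin T → Fin K → ℝ) :
    0 ≤ upperTerm a τ π ν k t l x := by
  unfold upperTerm
  split_ifs <;> positivity

theorem upperCoeff_nonneg {a ρ q : ℝ} (ha : 0 < a) (hρ : 0 < ρ) (hq : 0 < q) (l : ℕ) :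
    0 ≤ upperCoeff a ρ q l := by
  have := slack_pos hρ (pow_pos hq l)
  unfold upperCoeff
  positivity

/-- Bias and radius cost `2 + ζ` radii, each at most three slacks, and the noise threshold costs one
more: `7 + 3 * ζ`. The factor `8` pays for passing from `n` to `n + 1`, a form that is also usable
without samples. -/
theorem index_sub_mean_le (hν : ν.HeavyTailed) {a ζ ρ q : ℝ} (ha : 1 < a) (hζ : 0 < ζ)
    (hq : 0 < q) (hqa : q ^ 4 = a) (hK : 0 < K) {τ : ℕ} (hτ : 0 < τ) (hρ : 0 < ρ)
    (hρ4 : ρ ^ 4 = (τ : ℝ) / K) {t : ℕ} (ht : t < T) (x : Fin T → Fin K → ℝ)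
    (hn0 : 0 < pullCount π k (t - τ) t x) :
    satMean a τ (π.history x t ht.le) k
        + (1 + ζ) * radius K τ (pullCount π k (t - τ) t x) - ν.mean ⟨t, ht⟩ k
      ≤ windowDrift ν τ t
        + 8 * (7 + 3 * ζ) * slack ρ (fourthRoot (pullCount π k (t - τ) t x + 1))
        + ∑ l ∈ Finset.range (level a T + 1),
            upperCoeff a ρ q l * upperTerm a τ π ν k t l x := by
  obtain ⟨n, hn⟩ : ∃ n, pullCount π k (t - τ) t x = n := ⟨_, rfl⟩
  rw [hn] at hn0 ⊢
  have hmain := (abs_le.1 (abs_satMean_sub_le hν ha ht x hn hn0)).2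
  have hrad := inv_levelLimit_le_radius (K := K) (τ := τ) ha hK hτ hn0
  have hnT : n ≤ T := by
    have := pullCount_le_sub (π := π) (k := k) (t - τ) t x
    omega
  have hlev := level_mono ha hn0 hnT
  have hsingle : upperCoeff a ρ q (level a n) * upperTerm a τ π ν k t (level a n) x
      ≤ ∑ l ∈ Finset.range (level a T + 1), upperCoeff a ρ q l * upperTerm a τ π ν k t l x :=
    Finset.single_le_sum (f := fun l => upperCoeff a ρ q l * upperTerm a τ π ν k t l x)
      (fun l _ => mul_nonneg (upperCoeff_nonneg (by linarith) hρ hq l)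
        (upperTerm_nonneg a τ t l x))
      (Finset.mem_range.2 (by omega))
  have hHn := lt_pow_level ha hn0
  have hHa := pow_level_le ha hn0
  have hn' : (0 : ℝ) < n := Nat.cast_pos.2 hn0
  have hu := fourthRoot_pos hn0
  have hc := radius_le_slack (K := K) (τ := τ) hρ hu hρ4 (fourthRoot_pow n)
  have hQ : 0 < q ^ level a n := pow_pos hq _
  have hQu : fourthRoot n ≤ q ^ level a n := by
    refine le_of_pow_le_pow_left₀ (n := 4) (by norm_num) hQ.le ?_
    rw [fourthRoot_pow, ← pow_mul, mul_comm, pow_mul, hqa]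
    exact hHn.le
  have hθ := slack_anti hρ hu hQu
  have hθ0 := slack_pos hρ hQ
  have hslack : slack ρ (fourthRoot n) ≤ 8 * slack ρ (fourthRoot (n + 1)) := by
    have h1 := fourthRoot_succ_le hn0
    have h2 := fourthRoot_pos (Nat.succ_pos n)
    simp only [Nat.succ_eq_add_one] at h2
    unfold slack
    have h3 : ρ / fourthRoot n ^ 3 ≤ 8 * (ρ / fourthRoot (n + 1) ^ 3) := by
      rw [mul_div_assoc', div_le_div_iff₀ (by positivity) (by positivity)]
      calc ρ * fourthRoot (n + 1) ^ 3 ≤ ρ * (2 * fourthRoot n) ^ 3 := by gcongr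
        _ = _ := by ring
    have h4 : 0 < 1 / ρ ^ 2 := by positivity
    linarith
  have hdev : noiseSum π ν (levelLimit a K τ (level a n)) k (t - τ) t x / n
      ≤ slack ρ (q ^ level a n)
        + upperCoeff a ρ q (level a n) * upperTerm a τ π ν k t (level a n) x := by
    have h1 : upperTerm a τ π ν k t (level a n) x
        = noiseSum π ν (levelLimit a K τ (level a n)) k (t - τ) t x ^ 4 := by
      rw [upperTerm, hn, if_pos]
      have : (n : ℝ) ≤ ⌈a ^ level a n⌉₊ := hHn.le.trans (Nat.le_ceil _)
      exact_mod_cast this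
    rw [h1, upperCoeff]
    set S := noiseSum π ν (levelLimit a K τ (level a n)) k (t - τ) t x
    set θ := slack ρ (q ^ level a n)
    set H := a ^ level a n
    have hH0 : 0 < H := hn'.trans hHn
    have h2 : S / n ≤ |S| / n := by gcongr; exact le_abs_self S
    have h3 := le_add_pow_div (v := |S| / n) (by positivity) hθ0
    have h4 : (|S| / n) ^ 4 / θ ^ 3 ≤ a ^ 4 / (H ^ 4 * θ ^ 3) * S ^ 4 := by
      have h5 : |S| / n ≤ a / H * |S| := by
        rw [div_mul_eq_mul_div, div_le_div_iff₀ hn' hH0]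
        nlinarith [mul_le_mul_of_nonneg_left hHa (abs_nonneg S)]
      have h6 : |S| ^ 4 = S ^ 4 := by rw [← abs_pow, abs_of_nonneg (by positivity)]
      calc (|S| / n) ^ 4 / θ ^ 3 ≤ (a / H * |S|) ^ 4 / θ ^ 3 := by gcongr
        _ = _ := by rw [mul_pow, h6]; field_simp
    linarith
  have h8 : (2 + ζ) * radius K τ n ≤ (2 + ζ) * (3 * slack ρ (fourthRoot n)) :=
    mul_le_mul_of_nonneg_left hc (by linarith)
  have h9 : (7 + 3 * ζ) * slack ρ (fourthRoot n)
      ≤ (7 + 3 * ζ) * (8 * slack ρ (fourthRoot (n + 1))) :=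
    mul_le_mul_of_nonneg_left hslack (by linarith)
  linarith

theorem loss_le (hν : ν.HeavyTailed) {a ζ ρ q : ℝ} (ha : 1 < a) (hζ : 0 < ζ)
    (hq : 0 < q) (hqa : q ^ 4 = a) (hK : 0 < K) {τ : ℕ} (hτ : 0 < τ) (hρ : 1 ≤ ρ)
    (hρ4 : ρ ^ 4 = (τ : ℝ) / K) (hπ : IsSWRMOSS a ζ τ π) (t : Fin T)
    (x : Fin T → Fin K → ℝ) {j : Fin K} (hj : ν.mean t j = ν.bestMean t) :
    ν.bestMean t - ν.mean t (π.arm x t) ≤ 2 * windowDrift ν τ t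
      + 8 * (7 + 3 * ζ) * slack ρ (fourthRoot (pullCount π (π.arm x t) (t - τ) t x + 1))
      + ∑ l ∈ Finset.range (level a T + 1), expCoeff a ζ K τ l * lowerTerm a ζ τ π ν j t l x
      + ∑ l ∈ Finset.range (level a T + 1),
          upperCoeff a ρ q l * upperTerm a τ π ν (π.arm x t) t l x := by
  have hρ0 : 0 < ρ := by linarith
  have hlow : 0 ≤ ∑ l ∈ Finset.range (level a T + 1),
      expCoeff a ζ K τ l * lowerTerm a ζ τ π ν j t l x :=
    Finset.sum_nonneg fun l _ => mul_nonneg (expCoeff_nonneg ha hζ K τ l) (Real.exp_pos _).le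
  have hup : 0 ≤ ∑ l ∈ Finset.range (level a T + 1),
      upperCoeff a ρ q l * upperTerm a τ π ν (π.arm x t) t l x :=
    Finset.sum_nonneg fun l _ => mul_nonneg (upperCoeff_nonneg (by linarith) hρ0 hq l)
      (upperTerm_nonneg a τ t l x)
  have hdr := windowDrift_nonneg ν τ t
  -- Without samples of the selected arm the loss is at most `2`, and `ρ ≥ 1` makes the slack term
  -- large enough. This covers the first `K` slots, where the selected arm is always new.
  rcases Nat.eq_zero_or_pos (pullCount π (π.arm x t) (t - τ) t x) with hn | hn
  · have h1 := bestMean_sub_le_two hν hK t (π.arm x t)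
    have h2 : 1 ≤ slack ρ (fourthRoot (0 + 1)) := by
      have : fourthRoot (0 + 1) = 1 := by simp [fourthRoot]
      rw [slack, this]
      have : 0 < 1 / ρ ^ 2 := by positivity
      simp only [one_pow, div_one]
      linarith
    rw [hn]
    nlinarith [mul_pos hζ (by linarith : 0 < slack ρ (fourthRoot (0 + 1)))]
  · have hcard : ∀ k, (windowSlots τ (π.history x t t.isLt.le) k).card
        = pullCount π k (t - τ) t x := fun k => card_windowSlots_history τ t t.isLt.le x
    have hKt : K ≤ t := by
      by_contra hlt
      push Not at hlt
      have h1 := hπ.initial t hlt (π.history x t t.isLt.le)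
      obtain ⟨s, hs⟩ := Finset.card_pos.1 (hn.trans_eq (hcard _).symm)
      simp only [windowSlots, Finset.mem_filter] at hs
      exact h1 s hs.2.2
    have hmax := hπ.maximal t hKt (π.history x t t.isLt.le) j
    change _ ≤ ucbIndex a ζ τ _ (π.arm x t) at hmax
    unfold ucbIndex at hmax
    rw [hcard, hcard, if_neg hn.ne'] at hmax
    -- An unsampled best arm would have index `⊤`, above the finite maximal index.
    have hnj : 0 < pullCount π j (t - τ) t x := by
      by_contra h0
      rw [if_pos (by omega)] at hmax
      exact absurd (top_le_iff.1 hmax) (EReal.coe_ne_top _)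
    rw [if_neg hnj.ne', EReal.coe_le_coe_iff] at hmax
    have h1 := mean_sub_index_le hν ha hζ hK hτ t.isLt x hnj
    have h2 := index_sub_mean_le hν ha hζ hq hqa hK hτ hρ0 hρ4 t.isLt x hn
    rw [← hj]
    simp only [Fin.eta] at h1 h2
    linarith

end

section

variable {K T : ℕ} {π : Policy K} {ν : Environment K T}

/-! ### The regret bound -/

theorem sum_arm_eq_sum_pulled (f : Fin K → ℕ → ℝ) (x : Fin T → Fin K → ℝ) :
    ∑ t : Fin T, f (π.arm x t) t = ∑ t ∈ Finset.range T, ∑ k, (pulled π k t x : ℝ) * f k t := by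
  rw [← Fin.sum_univ_eq_sum_range (fun t => ∑ k, (pulled π k t x : ℝ) * f k t)]
  refine Finset.sum_congr rfl fun t _ => ?_
  simp [pulled]

/-- The arm `j t` does not depend on the rewards, so the supermartingale bound applies slot by slot.
-/
theorem lintegral_sum_lowerTerm_le (hπ : ∀ t, Measurable (π t)) (hν : ν.HeavyTailed) {a ζ : ℝ}
    (ha : 1 < a) (hζ : 0 < ζ) (τ n : ℕ) (j : Fin T → Fin K) :
    ∫⁻ x, ENNReal.ofReal (∑ t : Fin T, ∑ l ∈ Finset.range n,
        expCoeff a ζ K τ l * lowerTerm a ζ τ π ν (j t) t l x) ∂ν.rewardLaw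
      ≤ ENNReal.ofReal (T * ∑ l ∈ Finset.range n, expCoeff a ζ K τ l) := by
  have hB : ∀ l, 0 < levelLimit a K τ l := fun l => levelLimit_pos ha l
  have hc : ∀ l, 0 ≤ expCoeff a ζ K τ l := fun l => expCoeff_nonneg ha hζ K τ l
  have h0 : ∀ x (t : Fin T) l, 0 ≤ expCoeff a ζ K τ l * lowerTerm a ζ τ π ν (j t) t l x :=
    fun x t l => mul_nonneg (hc l) (Real.exp_pos _).le
  have hm : ∀ (t : Fin T) l, Measurable fun x =>
      ENNReal.ofReal (lowerTerm a ζ τ π ν (j t) t l x) := by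
    intro t l
    have h1 := measurable_noiseSum (ν := ν) (k := j t) hπ (hB l).le (t - τ) t
    have h2 : Measurable fun x : Fin T → Fin K → ℝ => (pullCount π (j t) (t - τ) t x : ℝ) :=
      measurable_from_top.comp (measurable_pullCount hπ (t - τ) t)
    unfold lowerTerm
    fun_prop
  calc _ = ∫⁻ x, ∑ t : Fin T, ∑ l ∈ Finset.range n, ENNReal.ofReal (expCoeff a ζ K τ l)
        * ENNReal.ofReal (lowerTerm a ζ τ π ν (j t) t l x) ∂ν.rewardLaw := by
        refine lintegral_congr fun x => ?_
        rw [ENNReal.ofReal_sum_of_nonneg fun t _ => Finset.sum_nonneg fun l _ => h0 x t l]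
        refine Finset.sum_congr rfl fun t _ => ?_
        rw [ENNReal.ofReal_sum_of_nonneg fun l _ => h0 x t l]
        exact Finset.sum_congr rfl fun l _ => ENNReal.ofReal_mul (hc l)
    _ = ∑ t : Fin T, ∑ l ∈ Finset.range n, ENNReal.ofReal (expCoeff a ζ K τ l)
        * ∫⁻ x, ENNReal.ofReal (lowerTerm a ζ τ π ν (j t) t l x) ∂ν.rewardLaw := by
        rw [lintegral_finsetSum _ fun t _ => by fun_prop]
        refine Finset.sum_congr rfl fun t _ => ?_
        rw [lintegral_finsetSum _ fun l _ => by fun_prop]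
        exact Finset.sum_congr rfl fun l _ => lintegral_const_mul _ (hm t l)
    _ ≤ ∑ t : Fin T, ∑ l ∈ Finset.range n, ENNReal.ofReal (expCoeff a ζ K τ l) * 1 := by
        refine Finset.sum_le_sum fun t _ => Finset.sum_le_sum fun l _ => mul_le_mul_right ?_ _
        exact lintegral_exp_noiseSum_le hπ hν (hB l) (expParam_pos ha hζ (hB l)) (Nat.sub_le _ _)
    _ = _ := by
        simp only [mul_one]
        rw [Finset.sum_const, Finset.card_univ, Fintype.card_fin, nsmul_eq_mul,
          ← ENNReal.ofReal_sum_of_nonneg fun l _ => hc l, ENNReal.ofReal_mul (by positivity),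
          ENNReal.ofReal_natCast]

theorem lintegral_sum_upperTerm_le (hπ : ∀ t, Measurable (π t)) (hν : ν.HeavyTailed) {a q ρ : ℝ}
    (ha : 1 < a) (hq : 1 < q) (hqa : q ^ 4 = a) (hρ : 0 < ρ) (τ n : ℕ) :
    ∫⁻ x, ENNReal.ofReal (∑ t : Fin T, ∑ l ∈ Finset.range n,
        upperCoeff a ρ q l * upperTerm a τ π ν (π.arm x t) t l x) ∂ν.rewardLaw
      ≤ ENNReal.ofReal (48384 * a ^ 4 * (4 * (q / (q - 1))) * (T / ρ ^ 2)) := by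
  have hq0 : 0 < q := by linarith
  have hc : ∀ l, 0 ≤ upperCoeff a ρ q l := fun l => upperCoeff_nonneg (by linarith) hρ hq0 l
  set U : ℕ → (Fin T → Fin K → ℝ) → ℝ := fun l x => ∑ k, ∑ t ∈ Finset.range T,
    (if pullCount π k (t - τ) t x ≤ ⌈a ^ l⌉₊ then
      (pulled π k t x : ℝ) * noiseSum π ν (levelLimit a K τ l) k (t - τ) t x ^ 4 else 0) with hU
  have hU0 : ∀ l x, 0 ≤ U l x := fun l x =>
    Finset.sum_nonneg fun k _ => Finset.sum_nonneg fun t _ => by split_ifs <;> positivity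
  have hUm : ∀ l, Measurable fun x => ENNReal.ofReal (U l x) := by
    intro l
    refine ENNReal.measurable_ofReal.comp (Finset.measurable_fun_sum _ fun k _ =>
      Finset.measurable_fun_sum _ fun t _ => Measurable.ite ?_ ?_ measurable_const)
    · exact measurable_pullCount hπ (t - τ) t (measurableSet_Iic (a := ⌈a ^ l⌉₊))
    · have h1 := measurable_noiseSum (ν := ν) (k := k) hπ
        (levelLimit_pos (K := K) (τ := τ) ha l).le (t - τ) t
      have h2 : Measurable fun x : Fin T → Fin K → ℝ => (pulled π k t x : ℝ) :=
        measurable_from_top.comp (measurable_pulled hπ t)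
      fun_prop
  have hsum : ∀ x, ∑ t : Fin T, ∑ l ∈ Finset.range n,
      upperCoeff a ρ q l * upperTerm a τ π ν (π.arm x t) t l x
      = ∑ l ∈ Finset.range n, upperCoeff a ρ q l * U l x := by
    intro x
    rw [Finset.sum_comm]
    refine Finset.sum_congr rfl fun l _ => ?_
    rw [← Finset.mul_sum, sum_arm_eq_sum_pulled (fun k t => upperTerm a τ π ν k t l x),
      Finset.sum_comm]
    congr 1
    refine Finset.sum_congr rfl fun k _ => Finset.sum_congr rfl fun t _ => ?_
    unfold upperTerm
    split_ifs <;> simp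
  have hbound : ∀ l, upperCoeff a ρ q l * (256 * ⌈a ^ l⌉₊
      * (27 / 8 * (8 * levelLimit a K τ l ^ 2 + 10 * ⌈a ^ l⌉₊)) * T)
      ≤ 48384 * a ^ 4 * (4 * bump (q ^ l * ρ⁻¹)) * (T / ρ ^ 2) := by
    intro l
    have hH1 : 1 ≤ a ^ l := one_le_pow₀ ha.le
    have hceil : (⌈a ^ l⌉₊ : ℝ) ≤ 2 * a ^ l := by
      have := Nat.ceil_lt_add_one (by linarith : 0 ≤ a ^ l)
      linarith
    have hB := levelLimit_sq_le (K := K) (τ := τ) ha l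
    have hQ : (q ^ l) ^ 8 = (a ^ l) ^ 2 := by
      rw [← hqa, ← pow_mul, ← pow_mul, ← pow_mul]; ring_nf
    have hs := slack_pos hρ (pow_pos hq0 l)
    have hmain := inv_slack_pow_le_bump (pow_pos hq0 l) hρ
    rw [hQ] at hmain
    have hcl := hc l
    -- `48384 = 256 * 2 * (27 / 8) * (8 + 20)`, from `⌈a ^ l⌉ ≤ 2 * a ^ l` and a squared saturation
    -- limit of at most `a ^ l`.
    calc _ ≤ upperCoeff a ρ q l * (256 * (2 * a ^ l)
          * (27 / 8 * (8 * a ^ l + 10 * (2 * a ^ l))) * T) := by gcongr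
      _ = 48384 * a ^ 4 * (1 / ((a ^ l) ^ 2 * slack ρ (q ^ l) ^ 3)) * T := by
          unfold upperCoeff
          field_simp
          ring
      _ ≤ 48384 * a ^ 4 * (4 * bump (q ^ l * ρ⁻¹) / ρ ^ 2) * T := by gcongr
      _ = _ := by ring
  calc _ = ∫⁻ x, ∑ l ∈ Finset.range n, ENNReal.ofReal (upperCoeff a ρ q l)
        * ENNReal.ofReal (U l x) ∂ν.rewardLaw := by
        refine lintegral_congr fun x => ?_
        rw [hsum, ENNReal.ofReal_sum_of_nonneg fun l _ => mul_nonneg (hc l) (hU0 l x)]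
        exact Finset.sum_congr rfl fun l _ => ENNReal.ofReal_mul (hc l)
    _ = ∑ l ∈ Finset.range n, ENNReal.ofReal (upperCoeff a ρ q l)
        * ∫⁻ x, ENNReal.ofReal (U l x) ∂ν.rewardLaw := by
        rw [lintegral_finsetSum _ fun l _ => (hUm l).const_mul _]
        exact Finset.sum_congr rfl fun l _ => lintegral_const_mul _ (hUm l)
    _ ≤ ∑ l ∈ Finset.range n, ENNReal.ofReal (upperCoeff a ρ q l)
        * ENNReal.ofReal (256 * ⌈a ^ l⌉₊
          * (27 / 8 * (8 * levelLimit a K τ l ^ 2 + 10 * ⌈a ^ l⌉₊)) * T) := by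
        refine Finset.sum_le_sum fun l _ => mul_le_mul_right ?_ _
        exact lintegral_sum_noiseSum_pow_le hπ hν (levelLimit_pos ha l).le
          (Nat.ceil_pos.2 (by positivity)) τ
    _ = ENNReal.ofReal (∑ l ∈ Finset.range n, upperCoeff a ρ q l * (256 * ⌈a ^ l⌉₊
          * (27 / 8 * (8 * levelLimit a K τ l ^ 2 + 10 * ⌈a ^ l⌉₊)) * T)) := by
        rw [ENNReal.ofReal_sum_of_nonneg fun l _ => mul_nonneg (hc l) (by positivity)]
        exact Finset.sum_congr rfl fun l _ => (ENNReal.ofReal_mul (hc l)).symm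
    _ ≤ _ := by
        apply ENNReal.ofReal_le_ofReal
        refine (Finset.sum_le_sum fun l _ => hbound l).trans ?_
        rw [← Finset.sum_mul, ← Finset.mul_sum, ← Finset.mul_sum]
        have := sum_bump_le hq (inv_pos.2 hρ) n
        gcongr

/-- Constant of the regret bound, where `q` is the fourth root of `a`. -/
def regretConst (a ζ q : ℝ) : ℝ :=
  8 * (7 + 3 * ζ) * 17 + 2 * a / Real.log (1 + 2 * ζ / a) * (4 * (q / (q - 1)))
    + 48384 * a ^ 4 * (4 * (q / (q - 1)))

theorem regretConst_pos {a ζ q : ℝ} (ha : 1 < a) (hζ : 0 < ζ) (hq : 1 < q) :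
    0 < regretConst a ζ q := by
  have h1 : 0 < q - 1 := by linarith
  have h2 : 0 < 2 * ζ / a := by positivity
  have h3 : 0 < Real.log (1 + 2 * ζ / a) := Real.log_pos (by linarith)
  unfold regretConst
  positivity

theorem regret_le (hν : ν.HeavyTailed) {a ζ ρ q : ℝ} (ha : 1 < a) (hζ : 0 < ζ)
    (hψ : 2 * a / ζ ≤ psi (2 * ζ / a)) (hq : 1 < q) (hqa : q ^ 4 = a) (hK : 0 < K) {τ : ℕ}
    (hτ : 0 < τ) (hτT : τ ≤ T) (hρ : 1 ≤ ρ) (hρ4 : ρ ^ 4 = (τ : ℝ) / K)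
    (hπ : IsSWRMOSS a ζ τ π) :
    π.regret ν ≤ 2 * (τ * ν.variation) + regretConst a ζ q * (T / ρ ^ 2) := by
  have hρ0 : 0 < ρ := by linarith
  have hq0 : 0 < q := by linarith
  have hq1 : 0 < q - 1 := by linarith
  have hlog : 0 < Real.log (1 + 2 * ζ / a) := by
    have : 0 < 2 * ζ / a := by positivity
    exact Real.log_pos (by linarith)
  choose j hj using fun t => ν.exists_mean_eq_bestMean hK t
  have hvar : 0 ≤ ν.variation := by
    rw [← sum_drift]; exact Finset.sum_nonneg fun r _ => drift_nonneg ν r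
  set n := level a T + 1
  set A : (Fin T → Fin K → ℝ) → ℝ := fun x => ∑ t : Fin T, ∑ l ∈ Finset.range n,
    expCoeff a ζ K τ l * lowerTerm a ζ τ π ν (j t) t l x with hA
  set D : (Fin T → Fin K → ℝ) → ℝ := fun x => ∑ t : Fin T, ∑ l ∈ Finset.range n,
    upperCoeff a ρ q l * upperTerm a τ π ν (π.arm x t) t l x with hD
  have hA0 : ∀ x, 0 ≤ A x := fun x => Finset.sum_nonneg fun t _ => Finset.sum_nonneg fun l _ =>
    mul_nonneg (expCoeff_nonneg ha hζ K τ l) (Real.exp_pos _).le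
  have hD0 : ∀ x, 0 ≤ D x := fun x => Finset.sum_nonneg fun t _ => Finset.sum_nonneg fun l _ =>
    mul_nonneg (upperCoeff_nonneg (by linarith) hρ0 hq0 l) (upperTerm_nonneg a τ t l x)
  have hloss0 : ∀ x, 0 ≤ ∑ t : Fin T, (ν.bestMean t - ν.mean t (π.arm x t)) := fun x =>
    Finset.sum_nonneg fun t _ => sub_nonneg.2 (ν.mean_le_bestMean t _)
  have hpt : ∀ x, ∑ t : Fin T, (ν.bestMean t - ν.mean t (π.arm x t))
      ≤ (2 * (τ * ν.variation) + 8 * (7 + 3 * ζ) * (17 * (T / ρ ^ 2))) + (A x + D x) := by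
    intro x
    have h1 := Finset.sum_le_sum fun t (_ : t ∈ Finset.univ) =>
      loss_le hν ha hζ hq0 hqa hK hτ hρ hρ4 hπ t x (hj t)
    rw [Finset.sum_add_distrib, Finset.sum_add_distrib, Finset.sum_add_distrib,
      ← Finset.mul_sum, ← Finset.mul_sum] at h1
    have h2 := sum_windowDrift_le ν τ
    rw [← Fin.sum_univ_eq_sum_range (fun t => windowDrift ν τ t)] at h2
    have h3 := sum_slack_le (π := π) hK hτ hτT hρ0 hρ4 x
    rw [← sum_arm_eq_sum_pulled
      (fun k t => slack ρ (fourthRoot (pullCount π k (t - τ) t x + 1)))] at h3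
    have h4 := mul_le_mul_of_nonneg_left h3 (by positivity : 0 ≤ 8 * (7 + 3 * ζ))
    simp only [hA, hD]
    linarith
  have hAm : Measurable A := by
    refine Finset.measurable_fun_sum _ fun t _ => Finset.measurable_fun_sum _ fun l _ => ?_
    have h1 := measurable_noiseSum (ν := ν) (k := j t) hπ.measurable
      (levelLimit_pos (K := K) (τ := τ) ha l).le (t - τ) t
    have h2 : Measurable fun x : Fin T → Fin K → ℝ => (pullCount π (j t) (t - τ) t x : ℝ) :=
      measurable_from_top.comp (measurable_pullCount hπ.measurable (t - τ) t)
    unfold lowerTerm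
    fun_prop
  have hbd0 : 0 ≤ 2 * (τ * ν.variation) + regretConst a ζ q * (T / ρ ^ 2) := by
    have := (regretConst_pos ha hζ hq).le
    positivity
  have hint : Integrable (fun x => ∑ t : Fin T, (ν.bestMean t - ν.mean t (π.arm x t)))
      ν.rewardLaw := integrable_finsetSum _ fun t _ =>
    (integrable_const _).sub (integrable_mean_arm hπ.measurable hν t)
  rw [regret_eq hπ.measurable hν, integral_eq_lintegral_of_nonneg_ae
    (by filter_upwards with x using hloss0 x) hint.aestronglyMeasurable]
  apply ENNReal.toReal_le_of_le_ofReal hbd0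
  calc _ ≤ ∫⁻ x, (ENNReal.ofReal (2 * (τ * ν.variation) + 8 * (7 + 3 * ζ) * (17 * (T / ρ ^ 2)))
        + (ENNReal.ofReal (A x) + ENNReal.ofReal (D x))) ∂ν.rewardLaw := by
        refine lintegral_mono fun x => ?_
        rw [← ENNReal.ofReal_add (hA0 x) (hD0 x), ← ENNReal.ofReal_add (by positivity)
          (add_nonneg (hA0 x) (hD0 x))]
        exact ENNReal.ofReal_le_ofReal (hpt x)
    _ = ENNReal.ofReal (2 * (τ * ν.variation) + 8 * (7 + 3 * ζ) * (17 * (T / ρ ^ 2)))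
        + (∫⁻ x, ENNReal.ofReal (A x) ∂ν.rewardLaw + ∫⁻ x, ENNReal.ofReal (D x) ∂ν.rewardLaw) := by
        rw [lintegral_add_left measurable_const, lintegral_add_left (by fun_prop)]
        simp
    _ ≤ ENNReal.ofReal (2 * (τ * ν.variation) + 8 * (7 + 3 * ζ) * (17 * (T / ρ ^ 2)))
        + (ENNReal.ofReal (T * (2 * a / Real.log (1 + 2 * ζ / a) * (4 * (q / (q - 1))) / ρ ^ 2))
          + ENNReal.ofReal (48384 * a ^ 4 * (4 * (q / (q - 1))) * (T / ρ ^ 2))) := by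
        gcongr
        · refine (lintegral_sum_lowerTerm_le hπ.measurable hν ha hζ τ n j).trans
            (ENNReal.ofReal_le_ofReal ?_)
          gcongr
          exact sum_expCoeff_le ha hζ hψ hq hqa hK hτ hρ0 hρ4 n
        · exact lintegral_sum_upperTerm_le hπ.measurable hν ha hq hqa hρ0 τ n
    _ = _ := by
        rw [← ENNReal.ofReal_add (by positivity) (by positivity),
          ← ENNReal.ofReal_add (by positivity) (by positivity)]
        congr 1
        unfold regretConst
        ring

end

end SWRMOSS

end

/-! ### Choice of the window length -/

open SWRMOSS

theorem theorem5 (a ζ : ℝ) (ha : 1 < a) (hζ : 0 < ζ)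
    (hψ : 2 * a / ζ ≤ SWRMOSS.psi (2 * ζ / a)) :
    ∃ C : ℝ, 0 < C ∧ ∀ (K T : ℕ) (V : ℝ), 0 < K → 0 < V →
      SWRMOSS.windowLength K T V ≤ T →
      ∀ π : SWRMOSS.Policy K, SWRMOSS.IsSWRMOSS a ζ (SWRMOSS.windowLength K T V) π →
        π.worstCaseRegret T V ≤
          ((C * ((K : ℝ) * V) ^ (1 / 3 : ℝ) * (T : ℝ) ^ (2 / 3 : ℝ) : ℝ) : EReal) := by
  set q : ℝ := a ^ (1 / 4 : ℝ) with hqdef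
  have hq : 1 < q := Real.one_lt_rpow ha (by norm_num)
  have hqa : q ^ 4 = a := by
    rw [hqdef, ← Real.rpow_natCast, ← Real.rpow_mul (by linarith)]; norm_num
  have hC := regretConst_pos ha hζ hq
  refine ⟨4 + regretConst a ζ q, by linarith, ?_⟩
  intro K T V hK hV hτT π hπ
  refine iSup₂_le fun ν hν => EReal.coe_le_coe_iff.2 ?_
  obtain ⟨hν, hvar⟩ := hν
  have hK' : (0 : ℝ) < K := Nat.cast_pos.2 hK
  rcases Nat.eq_zero_or_pos T with rfl | hT
  · have := regret_le_two_mul hπ.measurable hν hK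
    have h0 : ((0 : ℕ) : ℝ) ^ (2 / 3 : ℝ) = 0 := by
      rw [Nat.cast_zero, Real.zero_rpow (by norm_num)]
    rw [h0, mul_zero]
    simpa using this
  have hT' : (0 : ℝ) < T := Nat.cast_pos.2 hT
  -- With `κ`, `v`, `s` the cube roots of `K`, `V`, `T`, all quantities are monomials.
  obtain ⟨κ, hκ, hκK⟩ : ∃ κ : ℝ, 0 < κ ∧ κ ^ 3 = K :=
    ⟨(K : ℝ) ^ (1 / 3 : ℝ), by positivity, by
      rw [← Real.rpow_natCast, ← Real.rpow_mul (by positivity)]; norm_num⟩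
  obtain ⟨v, hv, hvV⟩ : ∃ v : ℝ, 0 < v ∧ v ^ 3 = V :=
    ⟨V ^ (1 / 3 : ℝ), by positivity, by
      rw [← Real.rpow_natCast, ← Real.rpow_mul (by positivity)]; norm_num⟩
  obtain ⟨s, hs, hsT⟩ : ∃ s : ℝ, 0 < s ∧ s ^ 3 = T :=
    ⟨(T : ℝ) ^ (1 / 3 : ℝ), by positivity, by
      rw [← Real.rpow_natCast, ← Real.rpow_mul (by positivity)]; norm_num⟩
  have hroot : ∀ y : ℝ, 0 < y → (y ^ 3) ^ (1 / 3 : ℝ) = y := fun y hy => by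
    rw [← Real.rpow_natCast, ← Real.rpow_mul hy.le]; norm_num
  have hroot2 : ∀ y : ℝ, 0 < y → (y ^ 3) ^ (2 / 3 : ℝ) = y ^ 2 := fun y hy => by
    rw [← Real.rpow_natCast, ← Real.rpow_mul hy.le, ← Real.rpow_natCast]; norm_num
  have hR : (4 + regretConst a ζ q) * ((K : ℝ) * V) ^ (1 / 3 : ℝ) * (T : ℝ) ^ (2 / 3 : ℝ)
      = (4 + regretConst a ζ q) * (κ * v * s ^ 2) := by
    rw [← hκK, ← hvV, ← hsT, ← mul_pow, hroot _ (by positivity), hroot2 _ hs]; ring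
  have hw : (K : ℝ) ^ (1 / 3 : ℝ) * ((T : ℝ) / V) ^ (2 / 3 : ℝ) = κ * (s / v) ^ 2 := by
    rw [← hκK, ← hvV, ← hsT, ← div_pow, hroot _ hκ, hroot2 _ (by positivity)]
  have hτdef : windowLength K T V = ⌈κ * (s / v) ^ 2⌉₊ := by rw [windowLength, hw]
  set τ := windowLength K T V with hτ_def
  rw [hR]
  have hw0 : 0 < κ * (s / v) ^ 2 := by positivity
  have hwτ : κ * (s / v) ^ 2 ≤ τ := by rw [hτdef]; exact Nat.le_ceil _
  -- If the window length before rounding is below `K`, the target already exceeds `T` up to a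
  -- constant, and the trivial bound `2 * T` suffices. Otherwise `ρ ≥ 1`.
  rcases lt_or_ge (κ * (s / v) ^ 2) K with hcase | hcase
  · refine (regret_le_two_mul hπ.measurable hν hK).trans ?_
    have h1 : (s / v) ^ 2 ≤ κ ^ 2 := by
      rw [← hκK] at hcase
      nlinarith
    have h2 : s ≤ κ * v := by
      have := (sq_le_sq₀ (by positivity) hκ.le).1 h1
      rwa [div_le_iff₀ hv] at this
    have h3 : s ^ 3 ≤ κ * v * s ^ 2 := by
      calc s ^ 3 = s * s ^ 2 := by ring
        _ ≤ κ * v * s ^ 2 := by gcongr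
    rw [← hsT]
    nlinarith [mul_pos hC (show 0 < κ * v * s ^ 2 by positivity)]
  · have hK1 : (1 : ℝ) ≤ K := Nat.one_le_cast.2 hK
    have hτ0 : 0 < τ := by
      have : (0 : ℝ) < τ := hw0.trans_le hwτ
      exact_mod_cast this
    -- Rounding up at most doubles a number that is at least `K ≥ 1`; with the factor `2` of the
    -- drift this gives the `4` in the constant.
    have hτw : (τ : ℝ) ≤ 2 * (κ * (s / v) ^ 2) := by
      have := Nat.ceil_lt_add_one hw0.le
      rw [← hτdef] at this
      linarith
    set L : ℝ := (τ : ℝ) / K with hL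
    have hL1 : 1 ≤ L := by rw [hL, le_div_iff₀ hK']; linarith
    set ρ : ℝ := L ^ (1 / 4 : ℝ) with hρdef
    have hρ : 1 ≤ ρ := Real.one_le_rpow hL1 (by norm_num)
    have hρ4 : ρ ^ 4 = (τ : ℝ) / K := by
      rw [← hL, hρdef, ← Real.rpow_natCast, ← Real.rpow_mul (by linarith)]; norm_num
    have hmain := regret_le hν ha hζ hψ hq hqa hK hτ0 hτT hρ hρ4 hπ
    have h1 : (τ : ℝ) * ν.variation ≤ 2 * (κ * v * s ^ 2) := by
      calc (τ : ℝ) * ν.variation ≤ 2 * (κ * (s / v) ^ 2) * V := by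
            refine (mul_le_mul_of_nonneg_left hvar (by positivity)).trans ?_
            gcongr
        _ = _ := by rw [← hvV]; field_simp
    have h2 : (T : ℝ) / ρ ^ 2 ≤ κ * v * s ^ 2 := by
      have h3 : s / (κ * v) ≤ ρ ^ 2 := by
        refine le_of_pow_le_pow_left₀ (n := 2) (by norm_num) (by positivity) ?_
        rw [← pow_mul, hρ4, le_div_iff₀ hK']
        refine le_trans (le_of_eq ?_) hwτ
        rw [← hκK]; field_simp
      rw [div_le_iff₀ (by positivity), ← hsT]
      calc s ^ 3 = κ * v * s ^ 2 * (s / (κ * v)) := by field_simp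
        _ ≤ _ := by gcongr
    have h4 := mul_le_mul_of_nonneg_left h2 hC.le
    linarith
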